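/- Let $V$ be a finite-dimensional vector space over the field $\mathbb{Z}_3$ with three elements, and let $B_1,B_2,B_3,B_4$ be any four (not necessarily distinct) linear bases of $V$. Then the multiset union $B$ of $B_1,B_2,B_3,B_4$, in which the multiplicity of a vector is the number of indices $i$ with the vector in $B_i$, is an additive basis of $V$: every $v\in V$ is a linear combination of the members of $B$, counted with multiplicity, with each coefficient either $0$ or $1$. (This is the case $p=3$ of the Additive Basis Conjecture, with $c(3)=4$.) -/

import Mathlib

open Classical in
/-- A multiset `B` of vectors is an additive basis of the `K`-vector space `S` if every element
of `S` is a linear combination of the elements of `B` with each coefficient either `0` or `1`.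
The coefficients are indexed by `B.ToType`, the type of the occurrences of the members of `B`,
so that an element of multiplicity `m` gets `m` independent coefficients. -/
def IsAdditiveBasis (K : Type*) {S : Type*} [Field K] [AddCommGroup S] [Module K S]
    (B : Multiset S) : Prop :=
  ∀ v : S, ∃ c : B.ToType → K, (∀ i, c i = 0 ∨ c i = 1) ∧ ∑ i, c i • (i : S) = v

/-- The finite linear basis `b`, as the multiset of its vectors. -/
noncomputable def basisMultiset {ι K S : Type*} [Fintype ι] [Field K] [AddCommGroup S] [Module K S]
    (b : Module.Basis ι K S) : Multiset S :=
  (Finset.univ : Finset ι).val.map b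

/-! Polynomial method. Let `n = dim V`, let `B` list the `4n` given vectors, and let a functional
`c` act on `R = 𝔽₃[t_b : b ∈ B]/(t_b²)` as multiplication by `∑ c(b) t_b`. If the product of the
squares of the coordinate functionals is nonzero in `R`, then the polynomial `∏ (xᵢ - vᵢ - 1)(xᵢ -
vᵢ + 1)` is nonzero at some sublist sum, and that sum is `v` (`exists_sublist_sum_eq`).

Cubes of functionals vanish in `R`, so this product is the only monomial of degree `2n` in the
coordinates that can be nonzero. Monomials can be lengthened one factor at a time as soon as no
nonzero element of degree below `2n` is killed by all coordinates (`eq_zero_of_forall_op_eq_zero`).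

Killed elements are cocycles of a complex computing `Ext(𝔽₃, R)` over `𝔽₃[x₁, …, xₙ]/(xᵢ³)`, built
from the periodic complexes `c, c², c, …` with periodicity operators `zᵢ`. The weight is twice the
degree in `t` plus three times the cohomological degree, so each `zᵢ` has weight `0`. The core is
`exact_twList_sqList`: over the polynomial ring in the `zᵢ` modulo the linear forms of a subspace
`W`, the complex is exact in weight `w` if `w + 4 dim W < #{b ∉ W'} + 4 dim W'` for all `W' ⊇ W`.
The proof is by induction on `B`. If `b ∈ W`, the factor `A[t]/t²` is filtered by two copies of `A`.
Otherwise `A[t]/t²` is compared with `A[t]/t³`, at the cost of one unit of weight; once a single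
functional `c` is nonzero at `b`, the twist of `A[t]/t³` by `c` reduces to the quotient by `z`. This
replaces `W` by `W + ⟨b⟩` and lowers the weight by `4` (`hasShortExact_kos`).

For four bases the inequality holds at `W = 0` for all `w < 4n`, since a subspace `W'` misses at
least `n - dim W'` vectors of each. -/

/-- A graded module with a differential of weight `3` together with commuting operators of
weight `2`, indexed by `C`, whose cubes vanish. -/
structure DiffMod (C A : Type*) [AddCommGroup C] [CommRing A] where
  X : Type
  [grp : AddCommGroup X]
  [mod : Module A X]
  d : X →ₗ[A] X
  op : C → X →ₗ[A] X
  gr : ℤ → Submodule A X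
  op_add : ∀ c c' x, op (c + c') x = op c x + op c' x
  d_d : ∀ x, d (d x) = 0
  d_op : ∀ c x, d (op c x) = op c (d x)
  op_op : ∀ c c' x, op c (op c' x) = op c' (op c x)
  op_cube : ∀ c x, op c (op c (op c x)) = 0
  gr_d : ∀ {w x}, x ∈ gr w → d x ∈ gr (w + 3)
  gr_op : ∀ {w x} c, x ∈ gr w → op c x ∈ gr (w + 2)

/-! ### Homological algebra of twisted differential modules. -/

namespace DiffMod

attribute [instance] grp mod

variable {C A : Type*} [AddCommGroup C] [CommRing A]

theorem gr_congr (M : DiffMod C A) {w w' : ℤ} {x : M.X} (h : x ∈ M.gr w) (e : w = w') :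
    x ∈ M.gr w' := e ▸ h

theorem op_zero (M : DiffMod C A) (x : M.X) : M.op 0 x = 0 := by
  have h := M.op_add 0 0 x
  simpa using h

theorem op_neg (M : DiffMod C A) (c : C) (x : M.X) : M.op (-c) x = -M.op c x := by
  have h := M.op_add c (-c) x
  rw [add_neg_cancel, op_zero] at h
  exact (neg_eq_of_add_eq_zero_right h.symm).symm

/-- Every cocycle of weight `w` is a coboundary. -/
def Exact (M : DiffMod C A) (w : ℤ) : Prop :=
  ∀ x ∈ M.gr w, M.d x = 0 → ∃ y ∈ M.gr (w - 3), M.d y = x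

/-- The total module of one step `M → M → M → ⋯` of the periodic complex with maps `c` and `c²`,
the period being recorded by the scalar `z`. -/
def tw (c : C) (z : A) (M : DiffMod C A) : DiffMod C A where
  X := M.X × M.X
  d := LinearMap.prod
    (M.d.comp (LinearMap.fst A M.X M.X) +
      z • (M.op c).comp ((M.op c).comp (LinearMap.snd A M.X M.X)))
    ((M.op c).comp (LinearMap.fst A M.X M.X) - M.d.comp (LinearMap.snd A M.X M.X))
  op c' := (M.op c').prodMap (M.op c')
  gr w := (M.gr w).prod (M.gr (w - 1))
  op_add a b x := by ext <;> simp [M.op_add]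
  d_d x := by
    ext <;> simp [M.d_d, M.d_op, M.op_cube]
  d_op a x := by
    ext <;> simp [M.d_op, M.op_op c a]
  op_op a b x := by ext <;> simp [M.op_op a b]
  op_cube a x := by ext <;> simp [M.op_cube]
  gr_d := by
    rintro w ⟨e, o⟩ ⟨he, ho⟩
    refine ⟨?_, ?_⟩
    · exact add_mem (M.gr_d he) (Submodule.smul_mem _ _
        (M.gr_congr (M.gr_op c (M.gr_op c ho)) (by ring)))
    · exact sub_mem (M.gr_congr (M.gr_op c he) (by ring)) (M.gr_congr (M.gr_d ho) (by ring))
  gr_op := by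
    rintro w ⟨e, o⟩ a ⟨he, ho⟩
    exact ⟨M.gr_op a he, M.gr_congr (M.gr_op a ho) (by ring)⟩

/-- Iterated `tw`; the head of the list is used first. -/
def twList : List (C × A) → DiffMod C A → DiffMod C A
  | [], M => M
  | p :: l, M => twList l (tw p.1 p.2 M)

/-- Maps that commute with the differential and with the operators from `S` and that raise the
weight by `k`. -/
structure IsHom (S : Set C) (M N : DiffMod C A) (k : ℤ) (f : M.X →ₗ[A] N.X) : Prop where
  comm_d : ∀ x, f (M.d x) = N.d (f x)
  comm_op : ∀ c ∈ S, ∀ x, f (M.op c x) = N.op c (f x)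
  comm_gr : ∀ {w x}, x ∈ M.gr w → f x ∈ N.gr (w + k)

theorem IsHom.tw {S : Set C} {M N : DiffMod C A} {k : ℤ} {f : M.X →ₗ[A] N.X}
    (h : IsHom S M N k f) {c : C} (hc : c ∈ S) (z : A) :
    IsHom S (tw c z M) (tw c z N) k (f.prodMap f) where
  comm_d := by
    rintro ⟨e, o⟩
    refine Prod.ext ?_ ?_
    · change f (M.d e + z • M.op c (M.op c o)) = N.d (f e) + z • N.op c (N.op c (f o))
      simp [h.comm_d, h.comm_op c hc]
    · change f (M.op c e - M.d o) = N.op c (f e) - N.d (f o)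
      simp [h.comm_d, h.comm_op c hc]
  comm_op := by
    rintro a ha ⟨e, o⟩
    exact Prod.ext (h.comm_op a ha e) (h.comm_op a ha o)
  comm_gr := by
    rintro w ⟨e, o⟩ ⟨he, ho⟩
    exact ⟨h.comm_gr he, N.gr_congr (h.comm_gr ho) (by ring)⟩

/-- `N` is a retract of `M`. -/
def Retract (S : Set C) (M N : DiffMod C A) : Prop :=
  ∃ (f : M.X →ₗ[A] N.X) (g : N.X →ₗ[A] M.X), IsHom S M N 0 f ∧ IsHom S N M 0 g ∧ ∀ x, f (g x) = x

theorem Retract.tw {S : Set C} {M N : DiffMod C A} (h : Retract S M N) {c : C} (hc : c ∈ S)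
    (z : A) : Retract S (tw c z M) (tw c z N) := by
  obtain ⟨f, g, hf, hg, hfg⟩ := h
  refine ⟨_, _, hf.tw hc z, hg.tw hc z, ?_⟩
  rintro ⟨e, o⟩
  exact Prod.ext (hfg e) (hfg o)

theorem Retract.twList {S : Set C} {l : List (C × A)} (hl : ∀ p ∈ l, p.1 ∈ S) :
    ∀ {M N : DiffMod C A}, Retract S M N → Retract S (twList l M) (twList l N) := by
  induction l with
  | nil => exact fun h => h
  | cons p l ih =>
    intro M N h
    exact ih (fun q hq => hl q (by simp [hq])) (h.tw (hl p (by simp)) p.2)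

theorem Retract.exact {S : Set C} {M N : DiffMod C A} (h : Retract S M N) {w : ℤ}
    (hM : M.Exact w) : N.Exact w := by
  obtain ⟨f, g, hf, hg, hfg⟩ := h
  intro x hx hdx
  obtain ⟨y, hy, hdy⟩ := hM (g x) (M.gr_congr (hg.comm_gr hx) (by ring))
    (by rw [← hg.comm_d, hdx, map_zero])
  exact ⟨f y, N.gr_congr (hf.comm_gr hy) (by ring), by rw [← hf.comm_d, hdy, hfg]⟩

/-- Short exact sequences `0 → K → M → N → 0` whose maps raise the weights by `p` and `q`. -/
structure ShortExact (S : Set C) (K M N : DiffMod C A) (p q : ℤ) (f : K.X →ₗ[A] M.X)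
    (g : M.X →ₗ[A] N.X) : Prop where
  hom_f : IsHom S K M p f
  hom_g : IsHom S M N q g
  inj : ∀ x, f x = 0 → x = 0
  comp : ∀ x, g (f x) = 0
  lift_f : ∀ {w x}, x ∈ M.gr w → g x = 0 → ∃ y ∈ K.gr (w - p), f y = x
  lift_g : ∀ {w x}, x ∈ N.gr w → ∃ y ∈ M.gr (w - q), g y = x

def HasShortExact (S : Set C) (K M N : DiffMod C A) (p q : ℤ) : Prop :=
  ∃ f g, ShortExact S K M N p q f g

theorem HasShortExact.tw {S : Set C} {K M N : DiffMod C A} {p q : ℤ}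
    (h : HasShortExact S K M N p q) {c : C} (hc : c ∈ S) (z : A) :
    HasShortExact S (tw c z K) (tw c z M) (tw c z N) p q := by
  obtain ⟨f, g, h⟩ := h
  refine ⟨_, _, h.hom_f.tw hc z, h.hom_g.tw hc z, ?_, ?_, ?_, ?_⟩
  · rintro ⟨e, o⟩ he
    exact Prod.ext (h.inj e (congrArg Prod.fst he)) (h.inj o (congrArg Prod.snd he))
  · rintro ⟨e, o⟩
    exact Prod.ext (h.comp e) (h.comp o)
  · rintro w ⟨e, o⟩ ⟨he, ho⟩ hx
    obtain ⟨e', he', rfl⟩ := h.lift_f he (congrArg Prod.fst hx)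
    obtain ⟨o', ho', rfl⟩ := h.lift_f ho (congrArg Prod.snd hx)
    exact ⟨(e', o'), ⟨he', K.gr_congr ho' (by ring)⟩, rfl⟩
  · rintro w ⟨e, o⟩ ⟨he, ho⟩
    obtain ⟨e', he', rfl⟩ := h.lift_g he
    obtain ⟨o', ho', rfl⟩ := h.lift_g ho
    exact ⟨(e', o'), ⟨he', M.gr_congr ho' (by ring)⟩, rfl⟩

theorem HasShortExact.twList {S : Set C} {l : List (C × A)} (hl : ∀ r ∈ l, r.1 ∈ S) {p q : ℤ} :
    ∀ {K M N : DiffMod C A}, HasShortExact S K M N p q →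
      HasShortExact S (twList l K) (twList l M) (twList l N) p q := by
  induction l with
  | nil => exact fun h => h
  | cons r l ih =>
    intro K M N h
    exact ih (fun s hs => hl s (by simp [hs])) (h.tw (hl r (by simp)) r.2)

theorem HasShortExact.exact_mid {S : Set C} {K M N : DiffMod C A} {p q w : ℤ}
    (h : HasShortExact S K M N p q) (hK : K.Exact (w - p)) (hN : N.Exact (w + q)) :
    M.Exact w := by
  obtain ⟨f, g, h⟩ := h
  intro x hx hdx
  obtain ⟨y, hy, hdy⟩ := hN (g x) (h.hom_g.comm_gr hx) (by rw [← h.hom_g.comm_d, hdx, map_zero])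
  obtain ⟨y', hy', rfl⟩ := h.lift_g hy
  have hy'' : y' ∈ M.gr (w - 3) := M.gr_congr hy' (by ring)
  have h0 : g (x - M.d y') = 0 := by rw [map_sub, h.hom_g.comm_d, hdy, sub_self]
  obtain ⟨k, hk, hfk⟩ := h.lift_f (sub_mem hx (M.gr_congr (M.gr_d hy'') (by ring))) h0
  obtain ⟨k', hk', rfl⟩ := hK k hk (h.inj _ (by
    rw [h.hom_f.comm_d, hfk, map_sub, hdx, M.d_d, sub_zero]))
  refine ⟨y' + f k', add_mem hy'' (M.gr_congr (h.hom_f.comm_gr hk') (by ring)), ?_⟩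
  rw [map_add, ← h.hom_f.comm_d, hfk]
  abel

/-- The connecting map of the long exact sequence goes from weight `w` of `N` to weight `w + 3 - p`
of `K`, as `d` has weight `3`. -/
theorem HasShortExact.exact_right {S : Set C} {K M N : DiffMod C A} {p w : ℤ}
    (h : HasShortExact S K M N p 0) (hM : M.Exact w) (hK : K.Exact (w + 3 - p)) :
    N.Exact w := by
  obtain ⟨f, g, h⟩ := h
  intro x hx hdx
  obtain ⟨y, hy, rfl⟩ := h.lift_g hx
  have hy' : y ∈ M.gr w := M.gr_congr hy (by ring)
  obtain ⟨k, hk, hfk⟩ := h.lift_f (M.gr_d hy') (by rw [h.hom_g.comm_d, hdx])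
  obtain ⟨k', hk', rfl⟩ := hK k hk (h.inj _ (by rw [h.hom_f.comm_d, hfk, M.d_d]))
  have hfk' : f k' ∈ M.gr w := M.gr_congr (h.hom_f.comm_gr hk') (by ring)
  obtain ⟨m, hm, hdm⟩ := hM (y - f k') (sub_mem hy' hfk')
    (by rw [map_sub, ← h.hom_f.comm_d, hfk, sub_self])
  exact ⟨g m, N.gr_congr (h.hom_g.comm_gr hm) (by ring), by
    rw [← h.hom_g.comm_d, hdm, map_sub, h.comp, sub_zero]⟩

/-- `M` has a contracting homotopy that commutes with the operators from `S`. -/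
def Contractible (S : Set C) (M : DiffMod C A) : Prop :=
  ∃ s : M.X →ₗ[A] M.X, (∀ c ∈ S, ∀ x, s (M.op c x) = M.op c (s x)) ∧
    (∀ {w x}, x ∈ M.gr w → s x ∈ M.gr (w - 3)) ∧ ∀ x, M.d (s x) + s (M.d x) = x

theorem Contractible.tw {S : Set C} {M : DiffMod C A} (h : Contractible S M) {c : C} (hc : c ∈ S)
    (z : A) : Contractible S (tw c z M) := by
  obtain ⟨s, hop, hgr, hs⟩ := h
  -- The odd part carries the differential `-d`, hence the sign.
  refine ⟨s.prodMap (-s), ?_, ?_, ?_⟩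
  · rintro a ha ⟨e, o⟩
    exact Prod.ext (hop a ha e) ((congrArg Neg.neg (hop a ha o)).trans (map_neg (M.op a) _).symm)
  · rintro w ⟨e, o⟩ ⟨he, ho⟩
    exact ⟨hgr he, neg_mem (M.gr_congr (hgr ho) (by ring))⟩
  · rintro ⟨e, o⟩
    have h1 := hs e
    have h2 := hs o
    refine Prod.ext ?_ ?_
    · change M.d (s e) + z • M.op c (M.op c (-s o)) + s (M.d e + z • M.op c (M.op c o)) = e
      simp only [map_add, map_neg, map_smul, hop c hc, smul_neg]
      rw [show M.d (s e) + -(z • M.op c (M.op c (s o))) + (s (M.d e) + z • M.op c (M.op c (s o))) =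
        M.d (s e) + s (M.d e) by abel, h1]
    · change M.op c (s e) - M.d (-s o) + -s (M.op c e - M.d o) = o
      simp only [map_sub, map_neg, hop c hc]
      rw [show M.op c (s e) - -M.d (s o) + -(M.op c (s e) - s (M.d o)) =
        M.d (s o) + s (M.d o) by abel, h2]

theorem Contractible.twList {S : Set C} {l : List (C × A)} (hl : ∀ r ∈ l, r.1 ∈ S) :
    ∀ {M : DiffMod C A}, Contractible S M → Contractible S (twList l M) := by
  induction l with
  | nil => exact fun h => h
  | cons r l ih =>
    intro M h
    exact ih (fun s hs => hl s (by simp [hs])) (h.tw (hl r (by simp)) r.2)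

theorem Contractible.exact {S : Set C} {M : DiffMod C A} (h : Contractible S M) (w : ℤ) :
    M.Exact w := by
  obtain ⟨s, -, hgr, hs⟩ := h
  intro x hx hdx
  exact ⟨s x, hgr hx, by simpa [hdx] using hs x⟩

end DiffMod

namespace DiffMod

variable {C A : Type*} [AddCommGroup C] [CommRing A]

theorem IsHom.retract {S : Set C} {M N : DiffMod C A} {f : M.X →ₗ[A] N.X} {g : N.X →ₗ[A] M.X}
    (hf : IsHom S M N 0 f) (hfg : ∀ x, f (g x) = x) (hgf : ∀ x, g (f x) = x)
    (hg : ∀ {w x}, x ∈ N.gr w → g x ∈ M.gr w) : Retract S M N := by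
  refine ⟨f, g, hf, ⟨fun x => ?_, fun c hc x => ?_, fun hx => ?_⟩, hfg⟩
  · rw [← hgf (M.d (g x)), hf.comm_d, hfg]
  · rw [← hgf (M.op c (g x)), hf.comm_op c hc, hfg]
  · rw [add_zero]
    exact hg hx

/-! ### Changing the list of operators -/

theorem retract_tw_swap (M : DiffMod C A) (c c' : C) (z z' : A) :
    Retract Set.univ (tw c' z' (tw c z M)) (tw c z (tw c' z' M)) := by
  have key : ∀ (M : DiffMod C A) (c c' : C) (z z' : A), ∃ f : (tw c' z' (tw c z M)).X →ₗ[A]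
      (tw c z (tw c' z' M)).X, IsHom Set.univ (tw c' z' (tw c z M)) (tw c z (tw c' z' M)) 0 f ∧
      ∀ x : (M.X × M.X) × (M.X × M.X), f x = ((x.1.1, x.2.1), (x.1.2, -x.2.2)) := by
    intro M c c' z z'
    -- Koszul sign: exchanging the two odd directions negates the doubly odd part.
    let f : ((M.X × M.X) × (M.X × M.X)) →ₗ[A] ((M.X × M.X) × (M.X × M.X)) :=
      { toFun := fun x => ((x.1.1, x.2.1), (x.1.2, -x.2.2))
        map_add' := fun x y => by ext <;> simp [add_comm]
        map_smul' := fun a x => by ext <;> simp }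
    refine ⟨f, ⟨?_, ?_, ?_⟩, fun x => rfl⟩
    · rintro ⟨⟨e0, e1⟩, ⟨o0, o1⟩⟩
      refine Prod.ext (Prod.ext ?_ ?_) (Prod.ext ?_ ?_)
      · change M.d e0 + z • M.op c (M.op c e1) + z' • M.op c' (M.op c' o0) =
          M.d e0 + z' • M.op c' (M.op c' o0) + z • M.op c (M.op c e1)
        abel
      · change M.op c' e0 - (M.d o0 + z • M.op c (M.op c o1)) =
          M.op c' e0 - M.d o0 + z • M.op c (M.op c (-o1))
        simp only [map_neg, smul_neg]
        abel
      · change M.op c e0 - M.d e1 + z' • M.op c' (M.op c' o1) =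
          M.op c e0 - (M.d e1 + z' • M.op c' (M.op c' (-o1)))
        simp only [map_neg, smul_neg]
        abel
      · change -(M.op c' e1 - (M.op c o0 - M.d o1)) =
          M.op c o0 - (M.op c' e1 - M.d (-o1))
        simp only [map_neg]
        abel
    · rintro a - ⟨⟨e0, e1⟩, ⟨o0, o1⟩⟩
      exact Prod.ext (Prod.ext rfl rfl) (Prod.ext rfl (map_neg (M.op a) o1).symm)
    · rintro w ⟨⟨e0, e1⟩, ⟨o0, o1⟩⟩ ⟨⟨h1, h2⟩, h3, h4⟩
      exact ⟨⟨M.gr_congr h1 (by ring), M.gr_congr h3 (by ring)⟩,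
        M.gr_congr h2 (by ring), neg_mem (M.gr_congr h4 (by ring))⟩
  obtain ⟨f, hf, hf'⟩ := key M c c' z z'
  obtain ⟨g, hg, hg'⟩ := key M c' c z' z
  refine ⟨f, g, hf, hg, fun x => ?_⟩
  rw [hg' x, hf']
  exact Prod.ext rfl (Prod.ext rfl (neg_neg _))

theorem retract_tw_neg (M : DiffMod C A) (c : C) (z : A) :
    Retract Set.univ (tw c z M) (tw (-c) (-z) M) := by
  have key : ∀ (c c' : C) (z z' : A), c' = -c → z' = -z → IsHom Set.univ (tw c z M) (tw c' z' M) 0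
      (LinearMap.prodMap LinearMap.id (-LinearMap.id)) := by
    rintro c _ z _ rfl rfl
    refine ⟨?_, ?_, ?_⟩
    · rintro ⟨e, o⟩
      refine Prod.ext ?_ ?_
      · change M.d e + z • M.op c (M.op c o) = M.d e + (-z) • M.op (-c) (M.op (-c) (-o))
        simp [op_neg]
      · change -(M.op c e - M.d o) = M.op (-c) e - M.d (-o)
        simp only [op_neg, map_neg]
        abel
    · rintro a - ⟨e, o⟩
      exact Prod.ext rfl (map_neg (M.op a) o).symm
    · rintro w ⟨e, o⟩ ⟨he, ho⟩
      exact ⟨M.gr_congr he (by ring), neg_mem (M.gr_congr ho (by ring))⟩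
  refine ⟨_, _, key c (-c) z (-z) rfl rfl, key (-c) c (-z) z (by simp) (by simp), ?_⟩
  rintro ⟨e, o⟩
  exact Prod.ext rfl (neg_neg _)

/-- A change of basis that keeps the tensor `∑ c ⊗ z` fixed: `c ⊗ z + c' ⊗ z' = c ⊗ (z - z') + (c' +
c) ⊗ z'`. -/
theorem retract_tw_transvect [CharP A 3] (M : DiffMod C A) (c c' : C) (z z' : A) :
    Retract Set.univ (tw c' z' (tw c z M)) (tw (c' + c) z' (tw c (z - z') M)) := by
  have h3 : (3 : A) = 0 := by exact_mod_cast CharP.cast_eq_zero A 3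
  -- In characteristic 3, `c'² - (c' + c)² = c(c' + 2c)`; the correction term on the doubly odd part
  -- absorbs this change of the square.
  let f : ((M.X × M.X) × (M.X × M.X)) →ₗ[A] ((M.X × M.X) × (M.X × M.X)) :=
    { toFun := fun x => ((x.1.1 + z' • (M.op c' x.2.2 + (2 : A) • M.op c x.2.2), x.1.2),
        (x.2.1 + x.1.2, x.2.2))
      map_add' := fun x y => by
        ext <;> simp only [Prod.fst_add, Prod.snd_add, map_add, smul_add] <;> abel
      map_smul' := fun a x => by
        ext <;> simp only [Prod.smul_fst, Prod.smul_snd, map_smul, RingHom.id_apply] <;> module }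
  let g : ((M.X × M.X) × (M.X × M.X)) →ₗ[A] ((M.X × M.X) × (M.X × M.X)) :=
    { toFun := fun x => ((x.1.1 - z' • (M.op c' x.2.2 + (2 : A) • M.op c x.2.2), x.1.2),
        (x.2.1 - x.1.2, x.2.2))
      map_add' := fun x y => by
        ext <;> simp only [Prod.fst_add, Prod.snd_add, map_add, smul_add] <;> abel
      map_smul' := fun a x => by
        ext <;> simp only [Prod.smul_fst, Prod.smul_snd, map_smul, RingHom.id_apply] <;> module }
  have hfg : ∀ x, f (g x) = x := fun x => by ext <;> simp [f, g]
  have hgf : ∀ x, g (f x) = x := fun x => by ext <;> simp [f, g]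
  have hgr : ∀ {w : ℤ} {x : M.X}, x ∈ M.gr (w - 1 - 1) →
      z' • (M.op c' x + (2 : A) • M.op c x) ∈ M.gr w := fun hx =>
    Submodule.smul_mem _ _ (add_mem (M.gr_congr (M.gr_op c' hx) (by ring))
      (Submodule.smul_mem _ _ (M.gr_congr (M.gr_op c hx) (by ring))))
  have hf : IsHom Set.univ (tw c' z' (tw c z M)) (tw (c' + c) z' (tw c (z - z') M)) 0 f := by
    refine ⟨?_, ?_, ?_⟩
    · rintro ⟨⟨e0, e1⟩, ⟨o0, o1⟩⟩
      refine Prod.ext (Prod.ext ?_ ?_) (Prod.ext ?_ ?_)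
      · change M.d e0 + z • M.op c (M.op c e1) + z' • M.op c' (M.op c' o0) +
          z' • (M.op c' (M.op c' e1 - (M.op c o0 - M.d o1)) +
            (2 : A) • M.op c (M.op c' e1 - (M.op c o0 - M.d o1))) =
          M.d (e0 + z' • (M.op c' o1 + (2 : A) • M.op c o1)) + (z - z') • M.op c (M.op c e1) +
          z' • M.op (c' + c) (M.op (c' + c) (o0 + e1))
        simp only [map_add, map_sub, map_smul, M.op_add, M.op_op c c', M.d_op]
        linear_combination (norm := module)
          h3 • (-z' • (M.op c' (M.op c o0) + M.op c (M.op c o0)))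
      · change M.op c e0 - M.d e1 + z' • M.op c' (M.op c' o1) =
          M.op c (e0 + z' • (M.op c' o1 + (2 : A) • M.op c o1)) - M.d e1 +
            z' • M.op (c' + c) (M.op (c' + c) o1)
        simp only [map_add, map_smul, M.op_add, M.op_op c c']
        linear_combination (norm := module)
          h3 • (-z' • (M.op c' (M.op c o1) + M.op c (M.op c o1)))
      · change M.op c' e0 - (M.d o0 + z • M.op c (M.op c o1)) +
            (M.op c e0 - M.d e1 + z' • M.op c' (M.op c' o1)) =
          M.op (c' + c) (e0 + z' • (M.op c' o1 + (2 : A) • M.op c o1)) -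
            (M.d (o0 + e1) + (z - z') • M.op c (M.op c o1))
        simp only [map_add, map_smul, M.op_add, M.op_op c c']
        linear_combination (norm := module)
          h3 • (-z' • (M.op c' (M.op c o1) + M.op c (M.op c o1)))
      · change M.op c' e1 - (M.op c o0 - M.d o1) =
          M.op (c' + c) e1 - (M.op c (o0 + e1) - M.d o1)
        simp only [map_add, M.op_add]
        abel
    · rintro a - ⟨⟨e0, e1⟩, ⟨o0, o1⟩⟩
      refine Prod.ext (Prod.ext ?_ rfl) (Prod.ext ?_ rfl)
      · change M.op a e0 + z' • (M.op c' (M.op a o1) + (2 : A) • M.op c (M.op a o1)) =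
          M.op a (e0 + z' • (M.op c' o1 + (2 : A) • M.op c o1))
        simp only [map_add, map_smul, M.op_op a]
      · exact (map_add (M.op a) _ _).symm
    · rintro w ⟨⟨e0, e1⟩, ⟨o0, o1⟩⟩ ⟨⟨h1, h2⟩, h3, h4⟩
      exact ⟨⟨M.gr_congr (add_mem h1 (hgr h4)) (by ring), M.gr_congr h2 (by ring)⟩,
        M.gr_congr (add_mem h3 h2) (by ring), M.gr_congr h4 (by ring)⟩
  refine hf.retract hfg hgf ?_
  rintro w ⟨⟨e0, e1⟩, ⟨o0, o1⟩⟩ ⟨⟨h1, h2⟩, h3, h4⟩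
  exact ⟨⟨sub_mem h1 (hgr h4), h2⟩, sub_mem h3 h2, h4⟩

end DiffMod

/-! ### Elimination in the list of operators. -/

namespace DiffMod

variable {C A : Type*} [AddCommGroup C] [CommRing A]

/-- Exactness for the list `l` implies exactness for the list `l'`. -/
def Implies (l l' : List (C × A)) : Prop :=
  ∀ (M : DiffMod C A) (w : ℤ), (twList l M).Exact w → (twList l' M).Exact w

theorem Implies.refl (l : List (C × A)) : Implies l l := fun _ _ h => h

theorem Implies.trans {l₁ l₂ l₃ : List (C × A)} (h : Implies l₁ l₂) (h' : Implies l₂ l₃) :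
    Implies l₁ l₃ := fun M w hM => h' M w (h M w hM)

theorem Implies.cons {l l' : List (C × A)} (h : Implies l l') (p : C × A) :
    Implies (p :: l) (p :: l') := fun M w hM => h (tw p.1 p.2 M) w hM

theorem implies_swap (p q : C × A) (l : List (C × A)) : Implies (p :: q :: l) (q :: p :: l) :=
  fun M _ hM => ((retract_tw_swap M p.1 q.1 p.2 q.2).twList (l := l) (by simp)).exact hM

theorem implies_neg (c : C) (z : A) (l : List (C × A)) :
    Implies ((c, z) :: l) ((-c, -z) :: l) :=
  fun M _ hM => ((retract_tw_neg M c z).twList (l := l) (by simp)).exact hM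

theorem implies_transvect [CharP A 3] (c c' : C) (z z' : A) (l : List (C × A)) :
    Implies ((c, z) :: (c', z') :: l) ((c, z - z') :: (c' + c, z') :: l) :=
  fun M _ hM => ((retract_tw_transvect M c c' z z').twList (l := l) (by simp)).exact hM

theorem implies_transvect_nsmul [CharP A 3] (c c' : C) (z z' : A) (l : List (C × A)) (k : ℕ) :
    Implies ((c, z + k * z') :: (c' - k • c, z') :: l) ((c, z) :: (c', z') :: l) := by
  induction k with
  | zero => simpa using Implies.refl _
  | succ k ih =>
    refine Implies.trans ?_ ih
    have h := implies_transvect c (c' - (k + 1) • c) (z + (k + 1 : ℕ) * z') z' l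
    rwa [show z + (k + 1 : ℕ) * z' - z' = z + k * z' by push_cast; ring,
      show c' - (k + 1) • c + c = c' - k • c by rw [add_smul, one_smul]; abel] at h

theorem implies_of_perm {l l' : List (C × A)} (h : l.Perm l') : Implies l l' := by
  induction h with
  | nil => exact fun M w hM => hM
  | cons p _ ih => exact ih.cons p
  | swap p q l => exact implies_swap q p l
  | trans _ _ ih ih' => exact ih.trans ih'

theorem implies_shear [CharP A 3] (c : C) (k : C × A → ℕ) (l : List (C × A)) (z : A) :
    Implies ((c, z + (l.map fun p => (k p : A) * p.2).sum) ::
      l.map fun p => (p.1 - k p • c, p.2)) ((c, z) :: l) := by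
  induction l with
  | nil => simpa using Implies.refl _
  | cons p l ih =>
    simp only [List.map_cons, List.sum_cons]
    rw [show z + ((k p : A) * p.2 + (l.map fun p => (k p : A) * p.2).sum) =
      z + (l.map fun p => (k p : A) * p.2).sum + k p * p.2 by ring]
    exact (implies_transvect_nsmul c p.1 _ p.2 _ (k p)).trans
      ((implies_swap _ _ _).trans ((ih.cons p).trans (implies_swap _ _ _)))

variable {V : Type*} [AddCommGroup V] [Module (ZMod 3) V] [Algebra (ZMod 3) A]

/-- The contraction of `∑ c ⊗ z` over the list with a vector. -/
def contract (l : List (Module.Dual (ZMod 3) V × A)) (v : V) : A :=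
  (l.map fun p => algebraMap (ZMod 3) A (p.1 v) * p.2).sum

/-- Gaussian elimination at `b`: nonzero elements of `ZMod 3` are `±1`, so a sign change normalises
the pivot, and shears clear the other functionals. Both moves preserve the tensor, hence `contract`.
-/
theorem exists_pivot [CharP A 3] {l : List (Module.Dual (ZMod 3) V × A)} {b : V}
    {p : Module.Dual (ZMod 3) V × A} (hp : p ∈ l) (hb : p.1 b ≠ 0) :
    ∃ (c : Module.Dual (ZMod 3) V) (z : A) (l' : List (Module.Dual (ZMod 3) V × A)),
      c b = 1 ∧ (∀ q ∈ l', q.1 b = 0) ∧ Implies ((c, z) :: l') l ∧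
      (∀ v, contract ((c, z) :: l') v = contract l v) ∧
      ∀ v, (∀ q ∈ l, q.1 v = 0) → c v = 0 ∧ ∀ q ∈ l', q.1 v = 0 := by
  obtain ⟨s, t, rfl⟩ := List.append_of_mem hp
  have hperm : (p :: (s ++ t)).Perm (s ++ p :: t) := List.perm_middle.symm
  obtain ⟨c, z, hc, himp, hcon, hker⟩ : ∃ (c : Module.Dual (ZMod 3) V) (z : A), c b = 1 ∧
      Implies ((c, z) :: (s ++ t)) (p :: (s ++ t)) ∧
      (∀ v, contract ((c, z) :: (s ++ t)) v = contract (p :: (s ++ t)) v) ∧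
      ∀ v, p.1 v = 0 → c v = 0 := by
    have h12 : p.1 b = 1 ∨ p.1 b = -1 := by
      generalize p.1 b = a at hb
      revert a; decide
    rcases h12 with h | h
    · exact ⟨p.1, p.2, h, fun M w hM => hM, fun v => rfl, fun v hv => hv⟩
    · refine ⟨-p.1, -p.2, by simp [h], ?_, fun v => by simp [contract], fun v hv => by simp [hv]⟩
      simpa using implies_neg (-p.1) (-p.2) (s ++ t)
  refine ⟨c, z + ((s ++ t).map fun q => (((q.1 b).val : ℕ) : A) * q.2).sum,
    (s ++ t).map fun q => (q.1 - (q.1 b).val • c, q.2), hc, ?_,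
    (implies_shear c (fun q => (q.1 b).val) (s ++ t) z).trans (himp.trans (implies_of_perm hperm)),
    ?_, ?_⟩
  · intro q hq
    obtain ⟨r, -, rfl⟩ := List.mem_map.1 hq
    simp [hc]
  · intro v
    have h1 : contract (s ++ p :: t) v = contract ((c, z) :: (s ++ t)) v := by
      rw [hcon]
      exact ((hperm.map _).sum_eq).symm
    rw [h1]
    simp only [contract, List.map_cons, List.sum_cons, List.map_map]
    induction (s ++ t) with
    | nil => simp
    | cons r l ih =>
      simp only [List.map_cons, List.sum_cons, Function.comp_apply, LinearMap.sub_apply,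
        LinearMap.smul_apply, nsmul_eq_mul, map_sub, map_mul, map_natCast] at ih ⊢
      linear_combination ih
  · intro v hv
    have hcv := hker v (hv p (by simp))
    refine ⟨hcv, fun q hq => ?_⟩
    obtain ⟨r, hr, rfl⟩ := List.mem_map.1 hq
    simp [hcv, hv r (by simp at hr ⊢; tauto)]

end DiffMod

/-! ### Adjoining `t` with `t² = 0` or `t³ = 0`. -/

namespace DiffMod

variable {C A : Type*} [AddCommGroup C] [CommRing A]

/-- The tensor product with `A[t]/t²`, on which `c` acts as multiplication by `β c * t`. -/
def sq (β : C →+ A) [CharP A 3] (M : DiffMod C A) : DiffMod C A where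
  X := M.X × M.X
  d := M.d.prodMap M.d
  op c := LinearMap.prod ((M.op c).comp (LinearMap.fst A M.X M.X))
    ((M.op c).comp (LinearMap.snd A M.X M.X) + β c • LinearMap.fst A M.X M.X)
  gr w := (M.gr w).prod (M.gr (w - 2))
  op_add a b x := by
    ext
    · simp [M.op_add]
    · simp only [map_add, LinearMap.prod_apply, Function.prod_apply, LinearMap.add_apply,
        LinearMap.comp_apply, LinearMap.smul_apply, LinearMap.snd_apply, LinearMap.fst_apply,
        M.op_add, Prod.snd_add]
      module
  d_d x := by ext <;> simp [M.d_d]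
  d_op a x := by ext <;> simp [M.d_op]
  op_op a b x := by
    ext
    · simp [M.op_op a b]
    · simp [M.op_op a b]
      module
  op_cube a x := by
    have h3 : (3 : A) = 0 := by exact_mod_cast CharP.cast_eq_zero A 3
    ext
    · simp [M.op_cube]
    · simp [M.op_cube]
      linear_combination (norm := module) h3 • (β a • M.op a (M.op a x.1))
  gr_d := by
    rintro w ⟨e, o⟩ ⟨he, ho⟩
    exact ⟨M.gr_d he, M.gr_congr (M.gr_d ho) (by ring)⟩
  gr_op := by
    rintro w ⟨e, o⟩ a ⟨he, ho⟩
    exact ⟨M.gr_op a he, add_mem (M.gr_congr (M.gr_op a ho) (by ring))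
      (Submodule.smul_mem _ _ (M.gr_congr he (by ring)))⟩

/-- The tensor product with `A[t]/t³`, on which `c` acts as multiplication by `β c * t`. -/
def cub (β : C →+ A) [CharP A 3] (M : DiffMod C A) : DiffMod C A where
  X := M.X × M.X × M.X
  d := M.d.prodMap (M.d.prodMap M.d)
  op c :=
    { toFun := fun x => (M.op c x.1, M.op c x.2.1 + β c • x.1, M.op c x.2.2 + β c • x.2.1)
      map_add' := fun x y => by ext <;> simp <;> abel
      map_smul' := fun a x => by ext <;> simp <;> module }
  gr w := (M.gr w).prod ((M.gr (w - 2)).prod (M.gr (w - 4)))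
  op_add a b x := by
    ext <;> simp [M.op_add] <;> module
  d_d x := by ext <;> simp [M.d_d]
  d_op a x := by ext <;> simp [M.d_op]
  op_op a b x := by
    ext
    · simp [M.op_op a b]
    · simp [M.op_op a b, smul_smul, mul_comm (β b)]
      abel
    · simp [M.op_op a b, smul_smul, mul_comm (β b)]
      abel
  op_cube a x := by
    -- In characteristic 3, `(c + βt)³ = c³ + β³t³`, and both cubes vanish.
    have h3 : (3 : A) = 0 := by exact_mod_cast CharP.cast_eq_zero A 3
    ext
    · simp [M.op_cube]
    · simp [M.op_cube]
      linear_combination (norm := module) h3 • (β a • M.op a (M.op a x.1))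
    · simp [M.op_cube]
      linear_combination (norm := module) h3 • (β a • M.op a (M.op a x.2.1) +
        β a • β a • M.op a x.1)
  gr_d := by
    rintro w ⟨x, y, z⟩ ⟨hx, hy, hz⟩
    exact ⟨M.gr_d hx, M.gr_congr (M.gr_d hy) (by ring), M.gr_congr (M.gr_d hz) (by ring)⟩
  gr_op := by
    rintro w ⟨x, y, z⟩ a ⟨hx, hy, hz⟩
    exact ⟨M.gr_op a hx, add_mem (M.gr_congr (M.gr_op a hy) (by ring))
      (Submodule.smul_mem _ _ (M.gr_congr hx (by ring))),
      add_mem (M.gr_congr (M.gr_op a hz) (by ring))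
      (Submodule.smul_mem _ _ (M.gr_congr hy (by ring)))⟩

variable [CharP A 3] (β : C →+ A) (M : DiffMod C A)

/-- The kernel is `t² M`, and `t²` has weight `4`. -/
theorem hasShortExact_cub_sq : HasShortExact Set.univ M (cub β M) (sq β M) 4 0 := by
  let f : M.X →ₗ[A] M.X × M.X × M.X := LinearMap.prod 0 (LinearMap.prod 0 LinearMap.id)
  let g : M.X × M.X × M.X →ₗ[A] M.X × M.X :=
    LinearMap.prod (LinearMap.fst A M.X _) ((LinearMap.fst A M.X M.X).comp (LinearMap.snd A M.X _))
  refine ⟨f, g, ⟨fun x => ?_, fun c _ x => ?_, fun hx => ?_⟩, ⟨fun x => rfl, fun c _ x => rfl, ?_⟩,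
    ?_, fun x => rfl, ?_, ?_⟩
  · exact Prod.ext (map_zero M.d).symm (Prod.ext (map_zero M.d).symm rfl)
  · refine Prod.ext (map_zero (M.op c)).symm (Prod.ext ?_ ?_)
    · change (0 : M.X) = M.op c 0 + β c • (0 : M.X)
      simp
    · change M.op c x = M.op c x + β c • (0 : M.X)
      simp
  · exact ⟨zero_mem _, zero_mem _, M.gr_congr hx (by ring)⟩
  · rintro w ⟨x, y, z⟩ ⟨hx, hy, hz⟩
    exact ⟨M.gr_congr hx (by ring), M.gr_congr hy (by ring)⟩
  · exact fun x hx => congrArg (fun y : M.X × M.X × M.X => y.2.2) hx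
  · rintro w ⟨x, y, z⟩ ⟨hx, hy, hz⟩ h
    exact ⟨z, hz, Prod.ext (congrArg Prod.fst h).symm (Prod.ext (congrArg Prod.snd h).symm rfl)⟩
  · rintro w ⟨x, y⟩ ⟨hx, hy⟩
    exact ⟨(x, y, 0), ⟨M.gr_congr hx (by ring), M.gr_congr hy (by ring), zero_mem _⟩, rfl⟩

theorem hasShortExact_sq : HasShortExact Set.univ M (sq β M) M 2 0 := by
  refine ⟨LinearMap.prod 0 LinearMap.id, LinearMap.fst A M.X M.X,
    ⟨fun x => ?_, fun c hc x => ?_, fun hx => ?_⟩, ⟨fun x => rfl, fun c _ x => rfl, ?_⟩,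
    ?_, fun x => rfl, ?_, ?_⟩
  · exact Prod.ext (map_zero M.d).symm rfl
  · refine Prod.ext (map_zero (M.op c)).symm ?_
    change M.op c x = M.op c x + β c • (0 : M.X)
    simp
  · exact ⟨zero_mem _, M.gr_congr hx (by ring)⟩
  · rintro w ⟨x, y⟩ ⟨hx, hy⟩
    exact M.gr_congr hx (by ring)
  · exact fun x hx => congrArg (fun y : M.X × M.X => y.2) hx
  · rintro w ⟨x, y⟩ ⟨hx, hy⟩ h
    exact ⟨y, hy, Prod.ext h.symm rfl⟩
  · intro w x hx
    exact ⟨(x, 0), ⟨M.gr_congr hx (by ring), zero_mem _⟩, rfl⟩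

theorem ShortExact.sq {S : Set C} {K M N : DiffMod C A} {p q : ℤ} {f : K.X →ₗ[A] M.X}
    {g : M.X →ₗ[A] N.X} (h : ShortExact S K M N p q f g) :
    ShortExact S (sq β K) (sq β M) (sq β N) p q (f.prodMap f) (g.prodMap g) := by
  have hom : ∀ {M N : DiffMod C A} {k : ℤ} {f : M.X →ₗ[A] N.X}, IsHom S M N k f →
      IsHom S (DiffMod.sq β M) (DiffMod.sq β N) k (f.prodMap f) := by
    intro M N k f h
    refine ⟨?_, ?_, ?_⟩
    · rintro ⟨e, o⟩
      exact Prod.ext (h.comm_d e) (h.comm_d o)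
    · rintro a ha ⟨e, o⟩
      refine Prod.ext (h.comm_op a ha e) ?_
      change f (M.op a o + β a • e) = N.op a (f o) + β a • f e
      rw [map_add, map_smul, h.comm_op a ha]
    · rintro w ⟨e, o⟩ ⟨he, ho⟩
      exact ⟨h.comm_gr he, N.gr_congr (h.comm_gr ho) (by ring)⟩
  refine ⟨hom h.hom_f, hom h.hom_g, ?_, ?_, ?_, ?_⟩
  · rintro ⟨e, o⟩ he
    exact Prod.ext (h.inj e (congrArg Prod.fst he)) (h.inj o (congrArg Prod.snd he))
  · rintro ⟨e, o⟩
    exact Prod.ext (h.comp e) (h.comp o)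
  · rintro w ⟨e, o⟩ ⟨he, ho⟩ hx
    obtain ⟨e', he', rfl⟩ := h.lift_f he (congrArg Prod.fst hx)
    obtain ⟨o', ho', rfl⟩ := h.lift_f ho (congrArg Prod.snd hx)
    exact ⟨(e', o'), ⟨he', K.gr_congr ho' (by ring)⟩, rfl⟩
  · rintro w ⟨e, o⟩ ⟨he, ho⟩
    obtain ⟨e', he', rfl⟩ := h.lift_g he
    obtain ⟨o', ho', rfl⟩ := h.lift_g ho
    exact ⟨(e', o'), ⟨he', M.gr_congr ho' (by ring)⟩, rfl⟩

end DiffMod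

/-! ### Reduction of the twist of `M[t]/t³` to `M/zM`. -/

namespace DiffMod

variable {C A : Type*} [AddCommGroup C] [CommRing A]

/-- A contractible submodule of the twist of `cub β M` by an element with `β c = 1`. -/
def kos (M : DiffMod C A) : DiffMod C A where
  X := (M.X × M.X × M.X) × (M.X × M.X × M.X)
  d :=
    { toFun := fun x => ((M.d x.1.1, M.d x.1.2.1, M.d x.1.2.2 + x.2.1),
        (-M.d x.2.1, x.1.1 - M.d x.2.2.1, x.1.2.1 - M.d x.2.2.2))
      map_add' := fun x y => by ext <;> simp <;> abel
      map_smul' := fun a x => by ext <;> simp [smul_sub] }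
  op c := ((M.op c).prodMap ((M.op c).prodMap (M.op c))).prodMap
    ((M.op c).prodMap ((M.op c).prodMap (M.op c)))
  gr w := ((M.gr w).prod ((M.gr (w - 2)).prod (M.gr (w - 4)))).prod
    ((M.gr (w - 1)).prod ((M.gr (w - 3)).prod (M.gr (w - 5))))
  op_add a b x := by ext <;> simp [M.op_add]
  d_d x := by ext <;> simp [M.d_d]
  d_op a x := by ext <;> simp [M.d_op]
  op_op a b x := by ext <;> simp [M.op_op a b]
  op_cube a x := by ext <;> simp [M.op_cube]
  gr_d := by
    rintro w ⟨⟨n0, n1, n2⟩, ⟨o0, o1, o2⟩⟩ ⟨⟨h0, h1, h2⟩, ⟨k0, k1, k2⟩⟩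
    exact ⟨⟨M.gr_d h0, M.gr_congr (M.gr_d h1) (by ring),
      add_mem (M.gr_congr (M.gr_d h2) (by ring)) (M.gr_congr k0 (by ring))⟩,
      neg_mem (M.gr_congr (M.gr_d k0) (by ring)),
      sub_mem (M.gr_congr h0 (by ring)) (M.gr_congr (M.gr_d k1) (by ring)),
      sub_mem (M.gr_congr h1 (by ring)) (M.gr_congr (M.gr_d k2) (by ring))⟩
  gr_op := by
    rintro w ⟨⟨n0, n1, n2⟩, ⟨o0, o1, o2⟩⟩ c ⟨⟨h0, h1, h2⟩, ⟨k0, k1, k2⟩⟩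
    exact ⟨⟨M.gr_op c h0, M.gr_congr (M.gr_op c h1) (by ring),
      M.gr_congr (M.gr_op c h2) (by ring)⟩, M.gr_congr (M.gr_op c k0) (by ring),
      M.gr_congr (M.gr_op c k1) (by ring), M.gr_congr (M.gr_op c k2) (by ring)⟩

/-- The differential contains identity maps from `n0` to `o1`, from `n1` to `o2` and from `o0` to
`n2`; the homotopy inverts them. -/
theorem contractible_kos (M : DiffMod C A) : Contractible Set.univ (kos M) := by
  let s : ((M.X × M.X × M.X) × (M.X × M.X × M.X)) →ₗ[A]
      ((M.X × M.X × M.X) × (M.X × M.X × M.X)) :=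
    { toFun := fun x => ((x.2.2.1, x.2.2.2, 0), (x.1.2.2, 0, 0))
      map_add' := fun x y => by ext <;> simp
      map_smul' := fun a x => by ext <;> simp }
  refine ⟨s, ?_, ?_, ?_⟩
  · rintro c - ⟨⟨n0, n1, n2⟩, ⟨o0, o1, o2⟩⟩
    exact Prod.ext (Prod.ext rfl (Prod.ext rfl (map_zero (M.op c)).symm))
      (Prod.ext rfl (Prod.ext (map_zero (M.op c)).symm (map_zero (M.op c)).symm))
  · rintro w ⟨⟨n0, n1, n2⟩, ⟨o0, o1, o2⟩⟩ ⟨⟨h0, h1, h2⟩, ⟨k0, k1, k2⟩⟩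
    exact ⟨⟨k1, M.gr_congr k2 (by ring), zero_mem _⟩, M.gr_congr h2 (by ring), zero_mem _,
      zero_mem _⟩
  · rintro ⟨⟨n0, n1, n2⟩, ⟨o0, o1, o2⟩⟩
    refine Prod.ext (Prod.ext ?_ (Prod.ext ?_ ?_)) (Prod.ext ?_ (Prod.ext ?_ ?_))
    · change M.d o1 + (n0 - M.d o1) = n0
      abel
    · change M.d o2 + (n1 - M.d o2) = n1
      abel
    · change M.d 0 + n2 + 0 = n2
      simp
    · change -M.d n2 + (M.d n2 + o0) = o0
      abel
    · change o1 - M.d 0 + 0 = o1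
      simp
    · change o2 - M.d 0 + 0 = o2
      simp

variable [CharP A 3] (β : C →+ A)

/-- On `M[t]/t³` the element `c` acts as `T = c + t`, with `T³ = 0`, so powers of `T` can replace
powers of `t`. `kos M` is the part of the twist whose even `T²`-coefficient is divisible by `z`; on
it the maps `T` and `zT²` become identities between coefficients. What remains is that coefficient
modulo `z`, shifted by the weight `4` of `t²`. Operators with `β a = 0` have no `t`-term and so act
coefficientwise in `T` as well. -/
theorem hasShortExact_kos {M N : DiffMod C A} {z : A} {g : M.X →ₗ[A] N.X}
    (h : ShortExact Set.univ M M N 0 0 (z • LinearMap.id) g) {c : C} (hc : β c = 1) :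
    HasShortExact {a | β a = 0} (kos M) (tw c z (cub β M)) N 0 (-4) := by
  have h3 : (3 : A) = 0 := by exact_mod_cast CharP.cast_eq_zero A 3
  -- The expansions in `t` of `n0 + T n1 + z T² n2` and `o0 + T o1 + T² o2`.
  let j : ((M.X × M.X × M.X) × (M.X × M.X × M.X)) →ₗ[A]
      ((M.X × M.X × M.X) × (M.X × M.X × M.X)) :=
    { toFun := fun x =>
        ((x.1.1 + M.op c x.1.2.1 + z • M.op c (M.op c x.1.2.2),
          x.1.2.1 + (2 * z) • M.op c x.1.2.2, z • x.1.2.2),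
        (x.2.1 + M.op c x.2.2.1 + M.op c (M.op c x.2.2.2),
          x.2.2.1 + (2 : A) • M.op c x.2.2.2, x.2.2.2))
      map_add' := fun x y => by ext <;> simp <;> abel
      map_smul' := fun a x => by ext <;> simp <;> module }
  let g' : ((M.X × M.X × M.X) × (M.X × M.X × M.X)) →ₗ[A] N.X :=
    { toFun := fun x => g x.1.2.2
      map_add' := fun x y => by simp
      map_smul' := fun a x => by simp }
  have hz : ∀ x, g (z • x) = 0 := h.comp
  refine ⟨j, g', ⟨?_, ?_, ?_⟩, ⟨?_, ?_, ?_⟩, ?_, ?_, ?_, ?_⟩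
  · rintro ⟨⟨n0, n1, n2⟩, ⟨o0, o1, o2⟩⟩
    refine Prod.ext (Prod.ext ?_ (Prod.ext ?_ ?_)) (Prod.ext ?_ (Prod.ext ?_ ?_))
    · change M.d n0 + M.op c (M.d n1) + z • M.op c (M.op c (M.d n2 + o0)) =
        M.d (n0 + M.op c n1 + z • M.op c (M.op c n2)) +
          z • M.op c (M.op c (o0 + M.op c o1 + M.op c (M.op c o2)))
      simp only [map_add, map_smul, M.d_op, M.op_cube, map_zero]
      module
    · change M.d n1 + (2 * z) • M.op c (M.d n2 + o0) =
        M.d (n1 + (2 * z) • M.op c n2) +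
          z • (M.op c (M.op c (o1 + (2 : A) • M.op c o2) +
            β c • (o0 + M.op c o1 + M.op c (M.op c o2))) +
              β c • M.op c (o0 + M.op c o1 + M.op c (M.op c o2)))
      simp only [map_add, map_smul, M.d_op, M.op_cube, hc]
      linear_combination (norm := module) h3 • (-z • M.op c (M.op c o1))
    · change z • (M.d n2 + o0) =
        M.d (z • n2) + z • (M.op c (M.op c o2 + β c • (o1 + (2 : A) • M.op c o2)) +
          β c • (M.op c (o1 + (2 : A) • M.op c o2) +
            β c • (o0 + M.op c o1 + M.op c (M.op c o2))))
      simp only [map_add, map_smul, hc]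
      linear_combination (norm := module)
        h3 • (-z • M.op c o1 - (2 * z) • M.op c (M.op c o2))
    · change -M.d o0 + M.op c (n0 - M.d o1) + M.op c (M.op c (n1 - M.d o2)) =
        M.op c (n0 + M.op c n1 + z • M.op c (M.op c n2)) -
          M.d (o0 + M.op c o1 + M.op c (M.op c o2))
      simp only [map_add, map_sub, map_smul, M.d_op, M.op_cube]
      module
    · change n0 - M.d o1 + (2 : A) • M.op c (n1 - M.d o2) =
        M.op c (n1 + (2 * z) • M.op c n2) + β c • (n0 + M.op c n1 + z • M.op c (M.op c n2)) -
          M.d (o1 + (2 : A) • M.op c o2)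
      simp only [map_add, map_sub, map_smul, M.d_op, hc]
      linear_combination (norm := module) h3 • (-z • M.op c (M.op c n2))
    · change n1 - M.d o2 = M.op c (z • n2) + β c • (n1 + (2 * z) • M.op c n2) - M.d o2
      simp only [map_smul, hc]
      linear_combination (norm := module) h3 • (-z • M.op c n2)
  · rintro a ha ⟨⟨n0, n1, n2⟩, ⟨o0, o1, o2⟩⟩
    replace ha : β a = 0 := ha
    refine Prod.ext (Prod.ext ?_ (Prod.ext ?_ ?_)) (Prod.ext ?_ (Prod.ext ?_ ?_))
    · change M.op a n0 + M.op c (M.op a n1) + z • M.op c (M.op c (M.op a n2)) =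
        M.op a (n0 + M.op c n1 + z • M.op c (M.op c n2))
      simp only [map_add, map_smul, M.op_op a c]
    · change M.op a n1 + (2 * z) • M.op c (M.op a n2) =
        M.op a (n1 + (2 * z) • M.op c n2) + β a • (n0 + M.op c n1 + z • M.op c (M.op c n2))
      simp only [map_add, map_smul, M.op_op a c, ha, zero_smul, add_zero]
    · change z • M.op a n2 = M.op a (z • n2) + β a • (n1 + (2 * z) • M.op c n2)
      simp only [map_smul, ha, zero_smul, add_zero]
    · change M.op a o0 + M.op c (M.op a o1) + M.op c (M.op c (M.op a o2)) =
        M.op a (o0 + M.op c o1 + M.op c (M.op c o2))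
      simp only [map_add, M.op_op a c]
    · change M.op a o1 + (2 : A) • M.op c (M.op a o2) =
        M.op a (o1 + (2 : A) • M.op c o2) + β a • (o0 + M.op c o1 + M.op c (M.op c o2))
      simp only [map_add, map_smul, M.op_op a c, ha, zero_smul, add_zero]
    · change M.op a o2 = M.op a o2 + β a • (o1 + (2 : A) • M.op c o2)
      simp only [ha, zero_smul, add_zero]
  · rintro w ⟨⟨n0, n1, n2⟩, ⟨o0, o1, o2⟩⟩ ⟨⟨h0, h1, h2⟩, ⟨k0, k1, k2⟩⟩
    refine ⟨⟨add_mem (add_mem ?_ ?_) (Submodule.smul_mem _ _ ?_),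
      add_mem ?_ (Submodule.smul_mem _ _ ?_), Submodule.smul_mem _ _ ?_⟩,
      add_mem (add_mem ?_ ?_) ?_, add_mem ?_ (Submodule.smul_mem _ _ ?_), ?_⟩
    all_goals first
      | exact M.gr_congr ‹_› (by ring)
      | exact M.gr_congr (M.gr_op c ‹_›) (by ring)
      | exact M.gr_congr (M.gr_op c (M.gr_op c ‹_›)) (by ring)
  · rintro ⟨⟨n0, n1, n2⟩, ⟨o0, o1, o2⟩⟩
    change g (M.d n2 + z • (M.op c (M.op c o2 + β c • o1) + β c • (M.op c o1 + β c • o0))) =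
      N.d (g n2)
    rw [map_add, hz, add_zero, h.hom_g.comm_d]
  · rintro a ha ⟨⟨n0, n1, n2⟩, ⟨o0, o1, o2⟩⟩
    replace ha : β a = 0 := ha
    change g (M.op a n2 + β a • n1) = N.op a (g n2)
    rw [ha, zero_smul, add_zero, h.hom_g.comm_op a trivial]
  · rintro w ⟨⟨n0, n1, n2⟩, ⟨o0, o1, o2⟩⟩ ⟨⟨h0, h1, h2⟩, ⟨k0, k1, k2⟩⟩
    exact N.gr_congr (h.hom_g.comm_gr h2) (by ring)
  · rintro ⟨⟨n0, n1, n2⟩, ⟨o0, o1, o2⟩⟩ hx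
    obtain rfl : n2 = 0 := h.inj n2 (congrArg (fun x => x.1.2.2) hx)
    obtain rfl : o2 = 0 := congrArg (fun x => x.2.2.2) hx
    have h_n1 : n1 + (2 * z) • M.op c 0 = 0 := congrArg (fun x => x.1.2.1) hx
    obtain rfl : n1 = 0 := by simpa using h_n1
    have h_o1 : o1 + (2 : A) • M.op c 0 = 0 := congrArg (fun x => x.2.2.1) hx
    obtain rfl : o1 = 0 := by simpa using h_o1
    have h_n0 : n0 + M.op c 0 + z • M.op c (M.op c 0) = 0 := congrArg (fun x => x.1.1) hx
    obtain rfl : n0 = 0 := by simpa using h_n0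
    have h_o0 : o0 + M.op c 0 + M.op c (M.op c 0) = 0 := congrArg (fun x => x.2.1) hx
    obtain rfl : o0 = 0 := by simpa using h_o0
    rfl
  · rintro ⟨⟨n0, n1, n2⟩, ⟨o0, o1, o2⟩⟩
    exact hz n2
  · rintro w ⟨⟨n0, n1, n2⟩, ⟨o0, o1, o2⟩⟩ ⟨⟨h0, h1, h2⟩, ⟨k0, k1, k2⟩⟩ hx
    obtain ⟨y, hy, rfl⟩ := h.lift_f h2 hx
    have hy' : y ∈ M.gr (w - 4) := M.gr_congr hy (by ring)
    -- Back to powers of `T`: `t = T - c`, and `t² = T² + cT + c²` modulo 3.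
    refine ⟨((n0 - M.op c n1 + M.op c (M.op c (z • y)), n1 + M.op c (z • y), y),
      (o0 - M.op c o1 + M.op c (M.op c o2), o1 + M.op c o2, o2)), ⟨⟨?_, ?_, ?_⟩, ?_, ?_, ?_⟩, ?_⟩
    · exact M.gr_congr (add_mem (sub_mem h0 (M.gr_congr (M.gr_op c h1) (by ring)))
        (M.gr_congr (M.gr_op c (M.gr_op c h2)) (by ring))) (by ring)
    · exact M.gr_congr (add_mem h1 (M.gr_congr (M.gr_op c h2) (by ring))) (by ring)
    · exact M.gr_congr hy' (by ring)
    · exact M.gr_congr (add_mem (sub_mem k0 (M.gr_congr (M.gr_op c k1) (by ring)))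
        (M.gr_congr (M.gr_op c (M.gr_op c k2)) (by ring))) (by ring)
    · exact M.gr_congr (add_mem k1 (M.gr_congr (M.gr_op c k2) (by ring))) (by ring)
    · exact M.gr_congr k2 (by ring)
    · refine Prod.ext (Prod.ext ?_ (Prod.ext ?_ rfl)) (Prod.ext ?_ (Prod.ext ?_ rfl))
      · change n0 - M.op c n1 + M.op c (M.op c (z • y)) + M.op c (n1 + M.op c (z • y)) +
          z • M.op c (M.op c y) = n0
        simp only [map_add, map_smul]
        linear_combination (norm := module) h3 • (z • M.op c (M.op c y))
      · change n1 + M.op c (z • y) + (2 * z) • M.op c y = n1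
        simp only [map_smul]
        linear_combination (norm := module) h3 • (z • M.op c y)
      · change o0 - M.op c o1 + M.op c (M.op c o2) + M.op c (o1 + M.op c o2) +
          M.op c (M.op c o2) = o0
        simp only [map_add]
        linear_combination (norm := module) h3 • M.op c (M.op c o2)
      · change o1 + M.op c o2 + (2 : A) • M.op c o2 = o1
        linear_combination (norm := module) h3 • M.op c o2
  · intro w x hx
    obtain ⟨y, hy, rfl⟩ := h.lift_g hx
    exact ⟨((0, 0, y), 0), ⟨⟨zero_mem _, zero_mem _, M.gr_congr hy (by ring)⟩, zero_mem _⟩, rfl⟩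

end DiffMod

/-! ### Cyclic coefficient modules and the vanishing theorem. -/

namespace DiffMod

variable {C A : Type*} [AddCommGroup C] [CommRing A]

theorem gr_twList_of_neg {M : DiffMod C A} (h : ∀ w < 0, M.gr w = ⊥) (l : List (C × A)) :
    ∀ w < 0, (twList l M).gr w = ⊥ := by
  induction l generalizing M with
  | nil => exact h
  | cons p l ih =>
    refine ih fun w hw => ?_
    change (M.gr w).prod (M.gr (w - 1)) = ⊥
    rw [h w hw, h (w - 1) (by omega), Submodule.prod_bot]

theorem exact_twList_of_neg {M : DiffMod C A} (h : ∀ w < 0, M.gr w = ⊥) (l : List (C × A))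
    {w : ℤ} (hw : w < 0) : (twList l M).Exact w := by
  intro x hx _
  rw [gr_twList_of_neg h l w hw, Submodule.mem_bot] at hx
  exact ⟨0, zero_mem _, by rw [map_zero, hx]⟩

/-- A cyclic module in weight `0`, with vanishing differential and operators. -/
noncomputable def base (C : Type*) [AddCommGroup C] {A : Type} [CommRing A] (I : Ideal A) :
    DiffMod C A where
  X := A ⧸ I
  d := 0
  op _ := 0
  gr w := if w = 0 then ⊤ else ⊥
  op_add _ _ _ := (add_zero _).symm
  d_d _ := rfl
  d_op _ _ := rfl
  op_op _ _ _ := rfl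
  op_cube _ _ := rfl
  gr_d _ := zero_mem _
  gr_op _ _ := zero_mem _

section base

variable {A : Type} [CommRing A]

theorem mem_base_gr {I : Ideal A} {w : ℤ} {x : (base C I).X} :
    x ∈ (base C I).gr w ↔ (w ≠ 0 → x = 0) := by
  change x ∈ (if w = 0 then ⊤ else ⊥ : Submodule A (base C I).X) ↔ _
  split_ifs with h
  · simp [h]
  · simp [h]

/-- Primality of `I` makes `z` a nonzerodivisor on `A ⧸ I`. -/
theorem shortExact_base {I J : Ideal A} {z : A} (hI : I.IsPrime) (hz : z ∉ I)
    (hJ : J = I ⊔ Ideal.span {z}) (hIJ : I ≤ J) :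
    ShortExact Set.univ (base C I) (base C I) (base C J) 0 0 (z • LinearMap.id)
      (Submodule.factor hIJ) := by
  have surj : ∀ {I : Ideal A} (x : (base C I).X), ∃ a : A, Submodule.Quotient.mk a = x :=
    fun x => Submodule.Quotient.mk_surjective _ x
  refine ⟨⟨fun x => smul_zero z, fun c _ x => smul_zero z, ?_⟩,
    ⟨fun x => map_zero _, fun c _ x => map_zero _, ?_⟩, ?_, ?_, ?_, ?_⟩
  · intro w x hx
    exact (base C I).gr_congr (Submodule.smul_mem _ z hx) (by ring)
  · intro w x hx
    rw [add_zero, mem_base_gr]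
    intro h
    obtain rfl := mem_base_gr.1 hx h
    exact map_zero (Submodule.factor hIJ)
  · intro x hx
    obtain ⟨a, rfl⟩ := surj x
    have : z * a ∈ I := (Submodule.Quotient.mk_eq_zero I).1 hx
    exact (Submodule.Quotient.mk_eq_zero I).2 ((hI.mem_or_mem this).resolve_left hz)
  · intro x
    obtain ⟨a, rfl⟩ := surj x
    refine (Submodule.Quotient.mk_eq_zero J).2 ?_
    rw [hJ]
    exact Ideal.mem_sup_right (Ideal.mul_mem_right _ _ (Ideal.mem_span_singleton_self z))
  · intro w x hx h
    by_cases hw : w = 0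
    · obtain ⟨a, rfl⟩ := surj x
      have ha : a ∈ J := (Submodule.Quotient.mk_eq_zero J).1 h
      rw [hJ] at ha
      obtain ⟨i, hi, s, hs, rfl⟩ := Submodule.mem_sup.1 ha
      obtain ⟨r, rfl⟩ := Ideal.mem_span_singleton.1 hs
      refine ⟨(Submodule.Quotient.mk r : A ⧸ I), mem_base_gr.2 fun h => (h (by omega)).elim, ?_⟩
      refine (Submodule.Quotient.eq I).2 ?_
      change z * r - (i + z * r) ∈ I
      rw [sub_add_cancel_right]
      exact neg_mem hi
    · obtain rfl := mem_base_gr.1 hx hw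
      exact ⟨0, zero_mem _, smul_zero z⟩
  · intro w x hx
    by_cases hw : w = 0
    · obtain ⟨a, rfl⟩ := surj x
      exact ⟨(Submodule.Quotient.mk a : A ⧸ I), mem_base_gr.2 fun h => (h (by omega)).elim, rfl⟩
    · obtain rfl := mem_base_gr.1 hx hw
      exact ⟨0, zero_mem _, map_zero (Submodule.factor hIJ)⟩

end base

section dual

variable {V : Type*} [AddCommGroup V] [Module (ZMod 3) V] {A : Type} [CommRing A]
  [Algebra (ZMod 3) A]

/-- Evaluation of functionals at `b`, with values in the algebra `A`. -/
def evalAt (A : Type) [CommRing A] [Algebra (ZMod 3) A] (b : V) :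
    Module.Dual (ZMod 3) V →+ A where
  toFun c := algebraMap (ZMod 3) A (c b)
  map_zero' := by simp
  map_add' c c' := by simp

/-- The ideal generated by the image of a subspace. -/
def idealOf (θ : V →ₗ[ZMod 3] A) (W : Submodule (ZMod 3) V) : Ideal A := Ideal.span (θ '' W)

theorem idealOf_sup_span (θ : V →ₗ[ZMod 3] A) (W : Submodule (ZMod 3) V) (b : V) :
    idealOf θ (W ⊔ Submodule.span (ZMod 3) {b}) = idealOf θ W ⊔ Ideal.span {θ b} := by
  apply le_antisymm
  · refine Ideal.span_le.2 ?_
    rintro _ ⟨v, hv, rfl⟩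
    obtain ⟨x, hx, y, hy, rfl⟩ := Submodule.mem_sup.1 hv
    obtain ⟨a, rfl⟩ := Submodule.mem_span_singleton.1 hy
    rw [map_add, map_smul, Algebra.smul_def]
    exact add_mem (Ideal.mem_sup_left (Ideal.subset_span ⟨x, hx, rfl⟩))
      (Ideal.mem_sup_right (Ideal.mul_mem_left _ _ (Ideal.mem_span_singleton_self _)))
  · refine sup_le (Ideal.span_mono (Set.image_mono fun x hx => Submodule.mem_sup_left hx)) ?_
    rw [Ideal.span_singleton_le_iff_mem]
    exact Ideal.subset_span ⟨b, Submodule.mem_sup_right (Submodule.mem_span_singleton_self b), rfl⟩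

variable [CharP A 3]

/-- Iterated `sq` along a list of vectors. -/
def sqList : List V → DiffMod (Module.Dual (ZMod 3) V) A → DiffMod (Module.Dual (ZMod 3) V) A
  | [], M => M
  | b :: B, M => sq (evalAt A b) (sqList B M)

theorem exists_shortExact_sqList (B : List V) {M N : DiffMod (Module.Dual (ZMod 3) V) A} {z : A}
    {g : M.X →ₗ[A] N.X} (h : ShortExact Set.univ M M N 0 0 (z • LinearMap.id) g) :
    ∃ g', ShortExact Set.univ (sqList B M) (sqList B M) (sqList B N) 0 0 (z • LinearMap.id) g' := by
  induction B with
  | nil => exact ⟨g, h⟩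
  | cons b B ih =>
    obtain ⟨g', h'⟩ := ih
    exact ⟨_, h'.sq (evalAt A b)⟩

-- The condition on `contract` keeps the tensor universal modulo the ideal of `W`. For `b ∉ W` it
-- forces some functional to be nonzero at `b`, and after elimination it identifies the parameter
-- `z` of the pivot with `θ b`, which is nonzero in the quotient domain.
open Classical in
theorem exact_twList_sqList [FiniteDimensional (ZMod 3) V] {θ : V →ₗ[ZMod 3] A}
    (hP : ∀ W, (idealOf θ W).IsPrime) (hθ : ∀ W v, θ v ∈ idealOf θ W → v ∈ W) (B : List V) :
    ∀ (W : Submodule (ZMod 3) V) (l : List (Module.Dual (ZMod 3) V × A)) (w : ℤ),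
      (∀ p ∈ l, ∀ v ∈ W, p.1 v = 0) → (∀ v, contract l v - θ v ∈ idealOf θ W) →
      (∀ W' ≥ W, w + 4 * Module.finrank (ZMod 3) W <
        B.countP (· ∉ W') + 4 * Module.finrank (ZMod 3) W') →
      (twList l (sqList B (base _ (idealOf θ W)))).Exact w := by
  induction B with
  | nil =>
    intro W l w _ _ hw
    -- The case `W' = W` says `w < 0`, where every weight space is zero.
    have h := hw W le_rfl
    rw [List.countP_nil] at h
    exact exact_twList_of_neg (fun w hw => if_neg hw.ne) l (by omega)
  | cons b B ih =>
    intro W l w hl hcon hw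
    by_cases hb : b ∈ W
    · have hw' : ∀ W' ≥ W, w + 4 * Module.finrank (ZMod 3) W <
          B.countP (· ∉ W') + 4 * Module.finrank (ZMod 3) W' := by
        intro W' hW'
        have h := hw W' hW'
        rwa [List.countP_cons_of_neg (by simpa using hW' hb)] at h
      -- No `W' ⊇ W` counts `b`, so the inequality for `w` passes to `B`, and then to `w - 2`.
      refine ((hasShortExact_sq _ _).twList (fun _ _ => Set.mem_univ _)).exact_mid
        (ih W l _ hl hcon fun W' hW' => ?_) (ih W l _ hl hcon fun W' hW' => ?_)
      all_goals
        have := hw' W' hW'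
        omega
    -- The kernel is needed in weight `w + 3 - 4 = w - 1`; the gain of `1` pays for the possible
    -- loss of `b` from the count.
    · refine ((hasShortExact_cub_sq _ _).twList (fun _ _ => Set.mem_univ _)).exact_right ?_
        (ih W l _ hl hcon fun W' hW' => ?_)
      · obtain ⟨p, hp, hpb⟩ : ∃ p ∈ l, p.1 b ≠ 0 := by
          by_contra! h
          have h0 : contract l b = 0 := by
            refine List.sum_eq_zero fun x hx => ?_
            obtain ⟨p, hp, rfl⟩ := List.mem_map.1 hx
            rw [h p hp, map_zero, zero_mul]
          have h1 := hcon b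
          rw [h0, zero_sub] at h1
          exact hb (hθ W b (neg_mem_iff.1 h1))
        obtain ⟨c, z, l', hc, hl', himp, hcon', hker⟩ := exists_pivot hp hpb
        have hcons : ∀ v, contract ((c, z) :: l') v =
          algebraMap (ZMod 3) A (c v) * z + contract l' v := fun v => rfl
        have hzb : z - θ b ∈ idealOf θ W := by
          have h0 : contract l' b = 0 := by
            refine List.sum_eq_zero fun x hx => ?_
            obtain ⟨p, hp, rfl⟩ := List.mem_map.1 hx
            rw [hl' p hp, map_zero, zero_mul]
          have h1 := hcon b
          rwa [← hcon' b, hcons, h0, hc, map_one, one_mul, add_zero] at h1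
        have hz : z ∉ idealOf θ W := fun h => hb (hθ W b (by
          simpa using sub_mem h hzb))
        have hJ : idealOf θ (W ⊔ Submodule.span (ZMod 3) {b}) =
            idealOf θ W ⊔ Ideal.span {z} := by
          rw [idealOf_sup_span]
          apply le_antisymm <;> refine sup_le le_sup_left ?_ <;>
            rw [Ideal.span_singleton_le_iff_mem]
          · rw [← sub_sub_cancel z (θ b)]
            exact sub_mem (Ideal.mem_sup_right (Ideal.mem_span_singleton_self z))
              (Ideal.mem_sup_left hzb)
          · rw [← sub_add_cancel z (θ b)]
            exact add_mem (Ideal.mem_sup_left hzb)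
              (Ideal.mem_sup_right (Ideal.mem_span_singleton_self _))
        have hle : idealOf θ W ≤ idealOf θ (W ⊔ Submodule.span (ZMod 3) {b}) := by
          rw [hJ]
          exact le_sup_left
        obtain ⟨g, hg⟩ := exists_shortExact_sqList B
          (shortExact_base (C := Module.Dual (ZMod 3) V) (hP W) hz hJ hle)
        have hcb : evalAt A b c = 1 := by simp [evalAt, hc]
        apply himp
        refine ((hasShortExact_kos (evalAt A b) hg hcb).twList (l := l') fun p hp => ?_).exact_mid
          (((contractible_kos _).twList fun _ _ => Set.mem_univ _).exact _) (ih _ l' _ ?_ ?_ ?_)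
        · change evalAt A b p.1 = 0
          simp [evalAt, hl' p hp]
        · intro p hp v hv
          obtain ⟨x, hx, y, hy, rfl⟩ := Submodule.mem_sup.1 hv
          obtain ⟨a, rfl⟩ := Submodule.mem_span_singleton.1 hy
          rw [map_add, map_smul, hl' p hp, smul_zero, add_zero]
          exact (hker x fun q hq => hl q hq x hx).2 p hp
        · intro v
          have h1 := hle (hcon v)
          rw [← hcon' v, hcons] at h1
          have h2 : z ∈ idealOf θ (W ⊔ Submodule.span (ZMod 3) {b}) := by
            rw [hJ]
            exact Ideal.mem_sup_right (Ideal.mem_span_singleton_self z)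
          have h3 := sub_mem h1 (Ideal.mul_mem_left _ (algebraMap (ZMod 3) A (c v)) h2)
          convert h3 using 1
          ring
        -- The weight falls by `4` while `4 dim W` rises by `4`, and `W'` contains `b`, so the
        -- inequality is unchanged.
        · intro W' hW'
          have hbW' : b ∈ W' :=
            hW' (Submodule.mem_sup_right (Submodule.mem_span_singleton_self b))
          have h := hw W' (le_sup_left.trans hW')
          rw [List.countP_cons_of_neg (by simpa using hbW')] at h
          have hr : Module.finrank (ZMod 3) ↥(W ⊔ Submodule.span (ZMod 3) {b}) =
              Module.finrank (ZMod 3) W + 1 := by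
            rw [Submodule.finrank_sup_span_singleton hb]
          rw [hr]
          push_cast
          omega
      · have h := hw W' hW'
        rw [List.countP_cons] at h
        split_ifs at h <;> push_cast at h <;> omega

end dual

end DiffMod

/-! ### Polynomial coefficients and specialisation at `z = 0`. -/

namespace DiffMod

variable {V : Type*} [AddCommGroup V] [Module (ZMod 3) V]

section idealOf

variable {n : ℕ} (e : Module.Basis (Fin n) (ZMod 3) V)

/-- The linear form with the coordinates of a vector as coefficients. -/
noncomputable def toLinearForm : V →ₗ[ZMod 3] MvPolynomial (Fin n) (ZMod 3) :=
  e.constr (ZMod 3) MvPolynomial.X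

theorem toLinearForm_basis (i : Fin n) : toLinearForm e (e i) = MvPolynomial.X i :=
  e.constr_basis _ _ i

theorem toLinearForm_apply (v : V) :
    toLinearForm e v = ∑ i, MvPolynomial.C (e.coord i v) * MvPolynomial.X i := by
  rw [toLinearForm, Module.Basis.constr_apply_fintype]
  simp [MvPolynomial.smul_eq_C_mul]

theorem toLinearForm_injective : Function.Injective (toLinearForm e) := by
  exact e.injective_constr_of_linearIndependent (MvPolynomial.linearIndependent_X _ _)

/-- The substitution induced by projecting along `W` onto a complement kills the forms of `W` and is
the identity modulo them, so its kernel is exactly their ideal. The target being a domain, this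
ideal is prime. -/
theorem exists_algHom_ker (W : Submodule (ZMod 3) V) :
    ∃ φ : MvPolynomial (Fin n) (ZMod 3) →ₐ[ZMod 3] MvPolynomial (Fin n) (ZMod 3),
      idealOf (toLinearForm e) W = RingHom.ker φ ∧
      ∀ v, φ (toLinearForm e v) = 0 → v ∈ W := by
  obtain ⟨U, hU⟩ := W.exists_isCompl
  let π : V →ₗ[ZMod 3] V := U.projection W hU.symm
  have hπW : ∀ v ∈ W, π v = 0 := fun v hv => by simp [π, hv]
  have hπ : ∀ v, v - π v ∈ W := fun v => by
    rw [← Submodule.projection_eq_self_sub_projection hU.symm v]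
    simp
  let φ : MvPolynomial (Fin n) (ZMod 3) →ₐ[ZMod 3] MvPolynomial (Fin n) (ZMod 3) :=
    MvPolynomial.aeval fun i => toLinearForm e (π (e i))
  have hφ : ∀ v, φ (toLinearForm e v) = toLinearForm e (π v) := by
    intro v
    have : φ.toLinearMap ∘ₗ toLinearForm e = toLinearForm e ∘ₗ π := by
      refine e.ext fun i => ?_
      simp [toLinearForm_basis, φ]
    exact LinearMap.congr_fun this v
  refine ⟨φ, le_antisymm ?_ ?_, ?_⟩
  · refine Ideal.span_le.2 ?_
    rintro _ ⟨v, hv, rfl⟩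
    change φ _ = 0
    rw [hφ, hπW v hv, map_zero]
  · intro a ha
    have hmk : (Ideal.Quotient.mkₐ (ZMod 3) (idealOf (toLinearForm e) W)).comp φ =
        Ideal.Quotient.mkₐ (ZMod 3) (idealOf (toLinearForm e) W) := by
      refine MvPolynomial.algHom_ext fun i => ?_
      rw [AlgHom.comp_apply, ← toLinearForm_basis e i, hφ]
      refine (Ideal.Quotient.eq.2 ?_).symm
      rw [← map_sub]
      exact Ideal.subset_span ⟨_, hπ _, rfl⟩
    have h := AlgHom.congr_fun hmk a
    rw [AlgHom.comp_apply, show φ a = 0 from ha, map_zero] at h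
    exact Ideal.Quotient.eq_zero_iff_mem.1 h.symm
  · intro v hv
    rw [hφ] at hv
    have h0 : π v = 0 := toLinearForm_injective e (by rw [hv, map_zero])
    have := hπ v
    rwa [h0, sub_zero] at this

theorem isPrime_idealOf (W : Submodule (ZMod 3) V) : (idealOf (toLinearForm e) W).IsPrime := by
  obtain ⟨φ, h, -⟩ := exists_algHom_ker e W
  rw [h]
  exact RingHom.ker_isPrime φ

theorem mem_of_toLinearForm_mem (W : Submodule (ZMod 3) V) (v : V)
    (hv : toLinearForm e v ∈ idealOf (toLinearForm e) W) : v ∈ W := by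
  obtain ⟨φ, h, h'⟩ := exists_algHom_ker e W
  rw [h] at hv
  exact h' v hv

end idealOf

section sqMap

variable {A A' : Type} [CommRing A] [CommRing A'] [Algebra (ZMod 3) A] [Algebra (ZMod 3) A']
  [CharP A 3] [CharP A' 3]

/-- The map between iterated `sq`s induced by a map of coefficients. -/
def sqMap {M : DiffMod (Module.Dual (ZMod 3) V) A} {N : DiffMod (Module.Dual (ZMod 3) V) A'}
    (φ : M.X →+ N.X) : (B : List V) → (sqList B M).X →+ (sqList B N).X
  | [] => φ
  | _ :: B => (sqMap φ B).prodMap (sqMap φ B)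

variable {M : DiffMod (Module.Dual (ZMod 3) V) A} {N : DiffMod (Module.Dual (ZMod 3) V) A'}
  {φ : M.X →+ N.X}

theorem sqMap_smul {a : A} {a' : A'} (h : ∀ x, φ (a • x) = a' • φ x) (B : List V) :
    ∀ x, sqMap φ B (a • x) = a' • sqMap φ B x := by
  induction B with
  | nil => exact h
  | cons b B ih =>
    rintro ⟨x, y⟩
    exact Prod.ext (ih x) (ih y)

theorem sqMap_op (hφ : ∀ (a : ZMod 3) x, φ (algebraMap (ZMod 3) A a • x) =
      algebraMap (ZMod 3) A' a • φ x) (hop : ∀ c x, φ (M.op c x) = N.op c (φ x)) (B : List V)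
    (c : Module.Dual (ZMod 3) V) :
    ∀ x, sqMap φ B ((sqList B M).op c x) = (sqList B N).op c (sqMap φ B x) := by
  induction B with
  | nil => exact hop c
  | cons b B ih =>
    rintro ⟨x, y⟩
    refine Prod.ext (ih x) ?_
    change sqMap φ B ((sqList B M).op c y + algebraMap (ZMod 3) A (c b) • x) =
      (sqList B N).op c (sqMap φ B y) + algebraMap (ZMod 3) A' (c b) • sqMap φ B x
    rw [map_add, ih, sqMap_smul (hφ (c b))]

theorem sqMap_gr (hφ : ∀ {w x}, x ∈ M.gr w → φ x ∈ N.gr w) (B : List V) :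
    ∀ {w x}, x ∈ (sqList B M).gr w → sqMap φ B x ∈ (sqList B N).gr w := by
  induction B with
  | nil => exact hφ
  | cons b B ih =>
    rintro w ⟨x, y⟩ ⟨hx, hy⟩
    exact ⟨ih hx, ih hy⟩

theorem sqMap_sqMap {ψ : N.X →+ M.X} (h : ∀ x, ψ (φ x) = x) (B : List V) :
    ∀ x, sqMap ψ B (sqMap φ B x) = x := by
  induction B with
  | nil => exact h
  | cons b B ih =>
    rintro ⟨x, y⟩
    exact Prod.ext (ih x) (ih y)

theorem sqList_d (h : ∀ x, M.d x = 0) (B : List V) : ∀ x, (sqList B M).d x = 0 := by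
  induction B with
  | nil => exact h
  | cons b B ih =>
    rintro ⟨x, y⟩
    exact Prod.ext (ih x) (ih y)

end sqMap

section inclusion

variable {C A : Type*} [AddCommGroup C] [CommRing A]

/-- The inclusion of a module in an iterated `tw` as the even part. -/
def inclusion : (l : List (C × A)) → (M : DiffMod C A) → M.X →ₗ[A] (twList l M).X
  | [], _ => LinearMap.id
  | p :: l, M => (inclusion l (tw p.1 p.2 M)).comp (LinearMap.inl A M.X M.X)

theorem inclusion_gr (l : List (C × A)) : ∀ {M : DiffMod C A} {w : ℤ} {x : M.X}, x ∈ M.gr w →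
    inclusion l M x ∈ (twList l M).gr w := by
  induction l with
  | nil => exact fun h => h
  | cons p l ih => exact fun h => ih (M := tw p.1 p.2 _) ⟨h, zero_mem _⟩

theorem d_inclusion (l : List (C × A)) : ∀ {M : DiffMod C A} {x : M.X}, M.d x = 0 →
    (∀ p ∈ l, M.op p.1 x = 0) → (twList l M).d (inclusion l M x) = 0 := by
  induction l with
  | nil => exact fun h _ => h
  | cons p l ih =>
    intro M x hd hop
    refine ih (M := tw p.1 p.2 M) ?_ fun q hq => ?_
    · change (M.d x + p.2 • M.op p.1 (M.op p.1 0), M.op p.1 x - M.d 0) = 0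
      rw [hop p (by simp), hd]
      simp
    · change (M.op q.1 x, M.op q.1 0) = 0
      rw [hop q (by simp [hq]), map_zero]
      rfl

/-- The purely even component of a coboundary is a value of `M.d` plus multiples of the parameters
`z`, and `ψ` kills both. -/
theorem eq_zero_of_inclusion_eq_d {G : Type*} [AddCommGroup G] (l : List (C × A)) :
    ∀ {M : DiffMod C A} (ψ : M.X →+ G), (∀ x, ψ (M.d x) = 0) →
      (∀ p ∈ l, ∀ x, ψ (p.2 • x) = 0) → ∀ x y, (twList l M).d y = inclusion l M x → ψ x = 0 := by
  induction l with
  | nil =>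
    intro M ψ hd _ x y h
    rw [show x = M.d y from h.symm]
    exact hd y
  | cons p l ih =>
    intro M ψ hd hz x y h
    refine ih (M := tw p.1 p.2 M) (ψ.comp (AddMonoidHom.fst M.X M.X)) ?_ ?_ (x, 0) y h
    · rintro ⟨e, o⟩
      change ψ (M.d e + p.2 • M.op p.1 (M.op p.1 o)) = 0
      rw [map_add, hd, hz p (by simp), add_zero]
    · rintro q hq ⟨e, o⟩
      exact hz q (by simp [hq]) e

end inclusion

-- After extending scalars to the polynomial ring, `x` becomes an even cocycle, hence a coboundary
-- by the vanishing theorem at `W = ⊥`. Setting all variables to `0` recovers `x` and kills the even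
-- part of coboundaries, since the untwisted differential is zero.
open Classical in
theorem eq_zero_of_forall_op_eq_zero {n : ℕ} (e : Module.Basis (Fin n) (ZMod 3) V) (B : List V)
    {w : ℤ} (hw : ∀ W : Submodule (ZMod 3) V,
      w < B.countP (· ∉ W) + 4 * Module.finrank (ZMod 3) W)
    {x : (sqList B (base (Module.Dual (ZMod 3) V) (⊥ : Ideal (ZMod 3)))).X}
    (hx : x ∈ (sqList B (base (Module.Dual (ZMod 3) V) (⊥ : Ideal (ZMod 3)))).gr w)
    (hop : ∀ i, (sqList B (base (Module.Dual (ZMod 3) V) (⊥ : Ideal (ZMod 3)))).op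
      (e.coord i) x = 0) : x = 0 := by
  have : FiniteDimensional (ZMod 3) V := Module.Basis.finiteDimensional_of_finite e
  set I := idealOf (toLinearForm e) ⊥ with hI
  let φ : (base (Module.Dual (ZMod 3) V) (⊥ : Ideal (ZMod 3))).X →+
      (base (Module.Dual (ZMod 3) V) I).X :=
    (Ideal.Quotient.lift ⊥ ((Ideal.Quotient.mk I).comp MvPolynomial.C)
      (by rintro a rfl; simp) : ZMod 3 ⧸ (⊥ : Ideal (ZMod 3)) →+* _).toAddMonoidHom
  let ψ : (base (Module.Dual (ZMod 3) V) I).X →+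
      (base (Module.Dual (ZMod 3) V) (⊥ : Ideal (ZMod 3))).X :=
    (Ideal.Quotient.lift I ((Ideal.Quotient.mk ⊥).comp MvPolynomial.constantCoeff) (by
      intro a ha
      have : I = ⊥ := by simp [hI, idealOf]
      rw [this, Ideal.mem_bot] at ha
      rw [ha, map_zero]) : MvPolynomial (Fin n) (ZMod 3) ⧸ I →+* _).toAddMonoidHom
  have hφ : ∀ (a : ZMod 3) x, φ (algebraMap (ZMod 3) (ZMod 3) a • x) =
      algebraMap (ZMod 3) (MvPolynomial (Fin n) (ZMod 3)) a • φ x := by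
    intro a x
    obtain ⟨b, rfl⟩ := Ideal.Quotient.mk_surjective x
    exact congrArg (Ideal.Quotient.mk I) (map_mul MvPolynomial.C a b)
  have hψφ : ∀ x, ψ (φ x) = x := by
    intro x
    obtain ⟨b, rfl⟩ := Ideal.Quotient.mk_surjective x
    exact congrArg (Ideal.Quotient.mk ⊥) (MvPolynomial.constantCoeff_C (Fin n) b)
  have hψX : ∀ (i : Fin n) x, ψ ((MvPolynomial.X i : MvPolynomial (Fin n) (ZMod 3)) • x) =
      (0 : ZMod 3) • ψ x := by
    intro i x
    obtain ⟨b, rfl⟩ := Ideal.Quotient.mk_surjective x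
    refine congrArg (Ideal.Quotient.mk ⊥) ?_
    change MvPolynomial.constantCoeff (MvPolynomial.X i * b) = 0 * MvPolynomial.constantCoeff b
    simp
  let l : List (Module.Dual (ZMod 3) V × MvPolynomial (Fin n) (ZMod 3)) :=
    List.ofFn fun i => (e.coord i, MvPolynomial.X i)
  have hex : (twList l (sqList B (base _ I))).Exact w := by
    refine exact_twList_sqList (isPrime_idealOf e) (mem_of_toLinearForm_mem e) B ⊥ l w ?_ ?_ ?_
    · rintro p - v hv
      rw [(Submodule.mem_bot _).1 hv, map_zero]
    · intro v
      have : contract l v = toLinearForm e v := by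
        rw [toLinearForm_apply, contract, List.map_ofFn, List.sum_ofFn]
        rfl
      rw [this, sub_self]
      exact zero_mem _
    · intro W _
      simpa using hw W
  have hopφ : ∀ i, (sqList B (base _ I)).op (e.coord i) (sqMap φ B x) = 0 := by
    intro i
    rw [← sqMap_op hφ (fun c x => map_zero φ), hop, map_zero]
  obtain ⟨y, -, hy⟩ := hex (inclusion l _ (sqMap φ B x))
    (inclusion_gr l (sqMap_gr (fun {w x} hx => mem_base_gr.2 fun h => by
      rw [mem_base_gr.1 hx h, map_zero]) B hx))
    (d_inclusion l (sqList_d (fun _ => rfl) B _) (by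
      intro p hp
      obtain ⟨i, rfl⟩ := List.mem_ofFn.1 hp
      exact hopφ i))
  have h := eq_zero_of_inclusion_eq_d l (sqMap ψ B)
    (fun x => by rw [sqList_d (fun _ => rfl), map_zero]) (by
      intro p hp x
      obtain ⟨i, rfl⟩ := List.mem_ofFn.1 hp
      rw [sqMap_smul (hψX i), zero_smul]) _ y hy
  rwa [sqMap_sqMap hψφ] at h

end DiffMod

/-! ### The polynomial method on sublist sums. -/

namespace DiffMod

variable {V : Type*} [AddCommGroup V] [Module (ZMod 3) V]

/-- The algebra `(ZMod 3)[t_b] / (t_b²)`, for `b` in the list `B`, with the action of the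
functionals. -/
noncomputable abbrev sqAlg (B : List V) : DiffMod (Module.Dual (ZMod 3) V) (ZMod 3) :=
  sqList B (base (Module.Dual (ZMod 3) V) (⊥ : Ideal (ZMod 3)))

/-- The iterated differences of a function at `0` along the sublists of `B`. -/
noncomputable def differences : (B : List V) → (V → ZMod 3) →ₗ[ZMod 3] (sqAlg B).X
  | [] => (Submodule.mkQ (⊥ : Ideal (ZMod 3))).comp (LinearMap.proj 0)
  | b :: B => LinearMap.prod (differences B) ((differences B).comp
      (LinearMap.funLeft (ZMod 3) (ZMod 3) (b + ·) - LinearMap.id))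

theorem differences_cons (b : V) (B : List V) (G : V → ZMod 3) :
    differences (b :: B) G =
      (differences B G, differences B (fun v => G (b + v) - G v)) := rfl

theorem differences_eq_zero (B : List V) : ∀ (G : V → ZMod 3),
    (∀ s : List V, s.Sublist B → G s.sum = 0) → differences B G = 0 := by
  induction B with
  | nil =>
    intro G h
    have h0 : G 0 = 0 := h [] (List.Sublist.refl _)
    change Submodule.mkQ (⊥ : Ideal (ZMod 3)) (G 0) = 0
    rw [h0, map_zero]
  | cons b B ih =>
    intro G h
    rw [differences_cons, ih G fun s hs => h s (hs.cons b), ih _ fun s hs => ?_]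
    · rfl
    · rw [h s (hs.cons b), ← List.sum_cons, h _ (hs.cons_cons b), sub_zero]

/-- The elements of degree at most `k`. -/
noncomputable def fil : (B : List V) → ℤ → Submodule (ZMod 3) (sqAlg B).X
  | [], k => if k < 0 then ⊥ else ⊤
  | _ :: B, k => (fil B k).prod (fil B (k - 1))

theorem fil_mono (B : List V) : Monotone (fil B) := by
  induction B with
  | nil =>
    intro k k' h
    change (if k < 0 then ⊥ else ⊤ : Submodule (ZMod 3) (sqAlg ([] : List V)).X) ≤
      if k' < 0 then ⊥ else ⊤
    split_ifs
    · exact le_rfl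
    · exact bot_le
    · omega
    · exact le_rfl
  | cons b B ih => exact fun k k' h => Submodule.prod_mono (ih h) (ih (by omega))

theorem op_mem_fil (B : List V) (c : Module.Dual (ZMod 3) V) : ∀ {k : ℤ} {x : (sqAlg B).X},
    x ∈ fil B k → (sqAlg B).op c x ∈ fil B (k + 1) := by
  induction B with
  | nil => exact fun _ => zero_mem _
  | cons b B ih =>
    rintro k ⟨x, y⟩ ⟨hx, hy⟩
    refine ⟨ih hx, add_mem ?_ (Submodule.smul_mem _ _ ?_)⟩
    · rw [add_sub_right_comm]
      exact ih hy
    · rw [add_sub_cancel_right]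
      exact hx

/-- Degree `j` sits in weight `2j`. -/
theorem eq_zero_of_mem_fil (B : List V) : ∀ {k w : ℤ} {x : (sqAlg B).X}, 2 * k < w →
    x ∈ fil B k → x ∈ (sqAlg B).gr w → x = 0 := by
  induction B with
  | nil =>
    intro k w x hk hx hw
    by_cases h : w = 0
    · change x ∈ (if k < 0 then ⊥ else ⊤ : Submodule (ZMod 3) (sqAlg ([] : List V)).X) at hx
      rw [if_pos (by omega)] at hx
      exact (Submodule.mem_bot _).1 hx
    · exact mem_base_gr.1 hw h
  | cons b B ih =>
    rintro k w ⟨x, y⟩ hk ⟨hx, hy⟩ ⟨hx', hy'⟩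
    exact Prod.ext (ih hk hx hx') (ih (by omega) hy hy')

/-- `differences B G` holds the coefficients of the multilinear polynomial representing `G` on
sublist sums. There `t_b² = t_b` instead of `0`, which alters only lower-degree terms, as does the
constant `r`. The constant must vary in the induction: differencing along `b` turns `r` into `r - c
b`. -/
theorem differences_mul_sub_op_mem (B : List V) (c : Module.Dual (ZMod 3) V) :
    ∀ {k : ℤ} {G : V → ZMod 3} (r : ZMod 3), differences B G ∈ fil B k →
      differences B (fun v => (c v - r) * G v) - (sqAlg B).op c (differences B G) ∈ fil B k := by
  induction B with
  | nil =>
    intro k G r h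
    change _ ∈ (if k < 0 then ⊥ else ⊤ : Submodule (ZMod 3) (sqAlg ([] : List V)).X) at h ⊢
    split_ifs at h ⊢ with hk
    · rw [(Submodule.mem_bot _).1 h, map_zero, sub_zero]
      have h' : differences ([] : List V) (fun v => (c v - r) * G v) =
        (c 0 - r) • differences ([] : List V) G := rfl
      rw [h', (Submodule.mem_bot _).1 h, smul_zero]
      exact zero_mem _
    · trivial
  | cons b B ih =>
    rintro k G r ⟨h1, h2⟩
    refine ⟨ih r h1, ?_⟩
    have h3 := ih (r - c b) h2
    have h4 : differences B (fun v => (c (b + v) - r) * G (b + v) - (c v - r) * G v) =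
        differences B (fun v => (c v - (r - c b)) * (G (b + v) - G v)) + c b • differences B G := by
      rw [← map_smul, ← map_add]
      congr 1
      funext v
      simp only [map_add, Pi.add_apply, Pi.smul_apply, smul_eq_mul]
      ring
    change differences B (fun v => (c (b + v) - r) * G (b + v) - (c v - r) * G v) -
      ((sqAlg B).op c (differences B fun v => G (b + v) - G v) + c b • differences B G) ∈
        fil B (k - 1)
    rw [h4, add_sub_add_right_eq_sub]
    exact h3

/-- The unit of the algebra. -/
noncomputable def one (B : List V) : (sqAlg B).X := differences B 1

theorem one_cons (b : V) (B : List V) : one (b :: B) = (one B, 0) := by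
  refine Prod.ext rfl ?_
  change differences B (fun v => 1 - 1) = 0
  rw [sub_self]
  exact map_zero _

theorem one_ne_zero (B : List V) : one B ≠ 0 := by
  induction B with
  | nil =>
    intro h
    exact _root_.one_ne_zero ((Submodule.Quotient.mk_eq_zero (⊥ : Ideal (ZMod 3))).1 h)
  | cons b B ih => exact fun h => ih (congrArg Prod.fst h)

theorem one_mem_gr (B : List V) : one B ∈ (sqAlg B).gr 0 := by
  induction B with
  | nil => exact mem_base_gr.2 fun h => (h rfl).elim
  | cons b B ih =>
    rw [one_cons]
    exact ⟨ih, zero_mem _⟩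

theorem one_mem_fil (B : List V) : one B ∈ fil B 0 := by
  induction B with
  | nil => exact Submodule.mem_top
  | cons b B ih =>
    rw [one_cons]
    exact ⟨ih, zero_mem _⟩

/-- The product of a list of functionals in the algebra. -/
noncomputable def prodOp (B : List V) (L : List (Module.Dual (ZMod 3) V)) : (sqAlg B).X :=
  L.foldr (fun c x => (sqAlg B).op c x) (one B)

theorem prodOp_mem_gr (B : List V) (L : List (Module.Dual (ZMod 3) V)) :
    prodOp B L ∈ (sqAlg B).gr (2 * L.length) := by
  induction L with
  | nil => exact one_mem_gr B
  | cons c L ih =>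
    refine (sqAlg B).gr_congr ((sqAlg B).gr_op c ih) ?_
    push_cast [List.length_cons]
    ring

theorem prodOp_perm (B : List V) {L L' : List (Module.Dual (ZMod 3) V)} (h : L.Perm L') :
    prodOp B L = prodOp B L' := by
  have : LeftCommutative fun (c : Module.Dual (ZMod 3) V) x => (sqAlg B).op c x :=
    ⟨fun c c' x => (sqAlg B).op_op c c' x⟩
  exact h.foldr_eq _

theorem differences_prod_sub_prodOp_mem (B : List V)
    (L : List (Module.Dual (ZMod 3) V × ZMod 3)) :
    differences B (fun v => (L.map fun q => q.1 v - q.2).prod) ∈ fil B L.length ∧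
    differences B (fun v => (L.map fun q => q.1 v - q.2).prod) - prodOp B (L.map Prod.fst) ∈
      fil B (L.length - 1) := by
  induction L with
  | nil =>
    refine ⟨one_mem_fil B, ?_⟩
    change one B - one B ∈ _
    rw [sub_self]
    exact zero_mem _
  | cons q L ih =>
    obtain ⟨ih1, ih2⟩ := ih
    have h1 := differences_mul_sub_op_mem B q.1 q.2 ih1
    have h2 := op_mem_fil B q.1 ih2
    rw [sub_add_cancel, map_sub] at h2
    have h3 := add_mem h1 h2
    rw [sub_add_sub_cancel] at h3
    have h4 := add_mem (fil_mono B (by omega : (L.length : ℤ) ≤ L.length + 1) h1)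
      (op_mem_fil B q.1 ih1)
    rw [sub_add_cancel] at h4
    push_cast [List.length_cons]
    rw [add_sub_cancel_right]
    exact ⟨h4, h3⟩

/-- If the product of the `q.1 - q.2` vanished at every sublist sum, all its coefficients would be
zero, yet its top-degree part is `prodOp`. -/
theorem exists_sublist_forall_ne (B : List V) {L : List (Module.Dual (ZMod 3) V × ZMod 3)}
    (hL : prodOp B (L.map Prod.fst) ≠ 0) :
    ∃ s : List V, s.Sublist B ∧ ∀ q ∈ L, q.1 s.sum ≠ q.2 := by
  by_contra! h
  have h0 : differences B (fun v => (L.map fun q => q.1 v - q.2).prod) = 0 := by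
    refine differences_eq_zero B _ fun s hs => ?_
    obtain ⟨q, hq, hqs⟩ := h s hs
    exact List.prod_eq_zero (List.mem_map.2 ⟨q, hq, by rw [hqs, sub_self]⟩)
  have h1 := (differences_prod_sub_prodOp_mem B L).2
  rw [h0, zero_sub, neg_mem_iff] at h1
  have h2 := prodOp_mem_gr B (L.map Prod.fst)
  rw [List.length_map] at h2
  exact hL (eq_zero_of_mem_fil B (by omega) h1 h2)

end DiffMod

/-! ### The top monomial and the representation of every vector. -/

namespace DiffMod

variable {V : Type*} [AddCommGroup V] [Module (ZMod 3) V] {n : ℕ}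

-- A product of `k < 2n` coordinates has weight `2k < 4n`, so if it is nonzero, some coordinate does
-- not kill it.
open Classical in
theorem exists_prodOp_ne_zero (e : Module.Basis (Fin n) (ZMod 3) V) (B : List V)
    (hB : ∀ W : Submodule (ZMod 3) V,
      4 * n ≤ B.countP (· ∉ W) + 4 * Module.finrank (ZMod 3) W) (k : ℕ) (hk : k ≤ 2 * n) :
    ∃ L : List (Fin n), L.length = k ∧ prodOp B (L.map e.coord) ≠ 0 := by
  induction k with
  | zero => exact ⟨[], rfl, one_ne_zero B⟩
  | succ k ih =>
    obtain ⟨L, hL, hne⟩ := ih (by omega)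
    by_contra! h
    refine hne (eq_zero_of_forall_op_eq_zero e B (fun W => ?_) (prodOp_mem_gr B _)
      fun i => h (i :: L) (by simp [hL]))
    have := hB W
    rw [List.length_map, hL]
    omega

theorem count_le_two_of_prodOp_ne_zero (e : Module.Basis (Fin n) (ZMod 3) V) (B : List V)
    {L : List (Fin n)} (hL : prodOp B (L.map e.coord) ≠ 0) (i : Fin n) : L.count i ≤ 2 := by
  by_contra! h
  obtain ⟨L', hL'⟩ := (List.replicate_sublist_iff.2 h).exists_perm_append
  refine hL ?_
  rw [prodOp_perm B (hL'.map e.coord)]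
  exact (sqAlg B).op_cube _ _

theorem perm_finRange_append (L : List (Fin n)) (h : ∀ i, L.count i ≤ 2)
    (hL : L.length = 2 * n) : L.Perm (List.finRange n ++ List.finRange n) := by
  have hsum : ∑ i, L.count i = ∑ _i : Fin n, 2 := by
    rw [Finset.sum_const, Finset.card_univ, Fintype.card_fin, smul_eq_mul, mul_comm, ← hL]
    simpa using Multiset.sum_count_eq_card (s := Finset.univ) (m := (L : Multiset (Fin n)))
      fun _ _ => Finset.mem_univ _
  rw [List.perm_iff_count]
  intro i
  rw [List.count_append, List.count_eq_one_of_mem (List.nodup_finRange n) (List.mem_finRange i)]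
  exact (Finset.sum_eq_sum_iff_of_le fun i _ => h i).1 hsum i (Finset.mem_univ i)

open Classical in
theorem exists_sublist_sum_eq (e : Module.Basis (Fin n) (ZMod 3) V) (B : List V)
    (hB : ∀ W : Submodule (ZMod 3) V,
      4 * n ≤ B.countP (· ∉ W) + 4 * Module.finrank (ZMod 3) W) (v : V) :
    ∃ s : List V, s.Sublist B ∧ s.sum = v := by
  obtain ⟨L, hL, hne⟩ := exists_prodOp_ne_zero e B hB (2 * n) le_rfl
  have hperm := perm_finRange_append L (count_le_two_of_prodOp_ne_zero e B hne) hL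
  rw [prodOp_perm B (hperm.map e.coord)] at hne
  -- Each coordinate is used twice, once to exclude `vᵢ + 1` and once to exclude `vᵢ - 1`.
  obtain ⟨s, hs, h⟩ := exists_sublist_forall_ne B
    (L := (List.finRange n).map (fun i => (e.coord i, e.coord i v + 1)) ++
      (List.finRange n).map fun i => (e.coord i, e.coord i v - 1))
    (by simpa [Function.comp_def] using hne)
  refine ⟨s, hs, e.ext_elem fun i => ?_⟩
  have h1 := h (e.coord i, e.coord i v + 1)
    (List.mem_append_left _ (List.mem_map.2 ⟨i, List.mem_finRange i, rfl⟩))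
  have h2 := h (e.coord i, e.coord i v - 1)
    (List.mem_append_right _ (List.mem_map.2 ⟨i, List.mem_finRange i, rfl⟩))
  simp only [Module.Basis.coord_apply] at h1 h2
  generalize e.repr s.sum i = x at h1 h2
  generalize e.repr v i = y at h1 h2
  revert x y
  decide

end DiffMod

/-! ### From sublists to 0/1 coefficients, and the count for four bases. -/

theorem Multiset.exists_le_map_eq {α β : Type*} {f : α → β} {m : Multiset α} {s : Multiset β}
    (h : s ≤ m.map f) : ∃ t ≤ m, t.map f = s := by
  induction m using Quotient.inductionOn with | _ l =>
  induction s using Quotient.inductionOn with | _ l' =>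
  obtain ⟨l₁, h₁, h₂⟩ : l'.Subperm (l.map f) := h
  obtain ⟨l₂, h₃, rfl⟩ := List.sublist_map_iff.1 h₂
  exact ⟨l₂, Multiset.coe_le.2 h₃.subperm, Quotient.sound h₁⟩

theorem isAdditiveBasis_of_forall_exists_le {K S : Type*} [Field K] [AddCommGroup S] [Module K S]
    {B : Multiset S} (h : ∀ v, ∃ s ≤ B, s.sum = v) : IsAdditiveBasis K B := by
  classical
  intro v
  obtain ⟨s, hs, rfl⟩ := h v
  rw [← Multiset.map_univ_coe B] at hs
  obtain ⟨t, ht, rfl⟩ := Multiset.exists_le_map_eq hs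
  -- `B.ToType` separates the occurrences of a vector, so a sub-multiset lifts to a set of
  -- occurrences.
  let T : Finset B.ToType := ⟨t, Multiset.nodup_of_le ht Finset.univ.nodup⟩
  refine ⟨fun i => if i ∈ T then 1 else 0, fun i => ?_, ?_⟩
  · by_cases hi : i ∈ T <;> simp [hi]
  · simp only [ite_smul, one_smul, zero_smul]
    rw [← Finset.sum_filter, Finset.filter_mem_eq_inter, Finset.univ_inter]
    rfl

-- The basis vectors lying in `W` are independent there, so at most `dim W` in number.
open Classical in
theorem card_le_countP_basisMultiset {ι K V : Type*} [Fintype ι] [Field K] [AddCommGroup V]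
    [Module K V] (b : Module.Basis ι K V) (W : Submodule K V) :
    Fintype.card ι ≤ (basisMultiset b).countP (· ∉ W) + Module.finrank K W := by
  have : FiniteDimensional K V := Module.Basis.finiteDimensional_of_finite b
  have h : Fintype.card {i // b i ∈ W} ≤ Module.finrank K W := by
    refine LinearIndependent.fintype_card_le_finrank
      (b := fun i : {i // b i ∈ W} => (⟨b i, i.2⟩ : W)) ?_
    refine LinearIndependent.of_comp W.subtype ?_
    exact b.linearIndependent.comp _ Subtype.val_injective
  rw [Fintype.card_subtype] at h
  rw [basisMultiset, Multiset.countP_map]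
  have h2 := Finset.card_filter_add_card_filter_not (s := (Finset.univ : Finset ι)) (fun i => b i ∈ W)
  rw [Finset.card_univ] at h2
  change _ ≤ (Finset.univ.filter fun i => b i ∉ W).card + _
  omega

/-- In a finite-dimensional vector space over `ZMod 3`, the multiset union (the sum of the
multiplicities) of any four linear bases is an additive basis. -/
theorem corollary4 {V : Type*} [AddCommGroup V] [Module (ZMod 3) V]
    {ι : Fin 4 → Type*} [∀ k, Fintype (ι k)]
    (b : (k : Fin 4) → Module.Basis (ι k) (ZMod 3) V) :
    IsAdditiveBasis (ZMod 3) (∑ k, basisMultiset (b k)) := by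
  classical
  refine isAdditiveBasis_of_forall_exists_le fun v => ?_
  have hcard : ∀ k, Fintype.card (ι k) = Fintype.card (ι 0) := fun k => by
    rw [← Module.finrank_eq_card_basis (b k), ← Module.finrank_eq_card_basis (b 0)]
  obtain ⟨B, hB⟩ : ∃ B : List V, (B : Multiset V) = ∑ k, basisMultiset (b k) :=
    Quot.exists_rep _
  have hW : ∀ W : Submodule (ZMod 3) V, 4 * Fintype.card (ι 0) ≤
      B.countP (· ∉ W) + 4 * Module.finrank (ZMod 3) W := fun W => by
    have h1 : B.countP (· ∉ W) = ∑ k, (basisMultiset (b k)).countP (· ∉ W) := by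
      rw [← Multiset.coe_countP, hB]
      exact map_sum (Multiset.countPAddMonoidHom (· ∉ W)) _ _
    have h2 : ∀ k, Fintype.card (ι 0) ≤
        (basisMultiset (b k)).countP (· ∉ W) + Module.finrank (ZMod 3) W :=
      fun k => (hcard k).symm.le.trans (card_le_countP_basisMultiset (b k) W)
    rw [h1, Fin.sum_univ_four]
    have := h2 0
    have := h2 1
    have := h2 2
    have := h2 3
    omega
  obtain ⟨s, hs, rfl⟩ := DiffMod.exists_sublist_sum_eq
    ((b 0).reindex (Fintype.equivFin (ι 0))) B hW v
  exact ⟨s, hB ▸ Multiset.coe_le.2 hs.subperm, Multiset.sum_coe s⟩
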